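/- **Kleene-Cartesian tapes.** Let $\mathcal S$ be a set of sorts and $\Sigma$ a monoidal signature over $\mathcal S$ (each symbol has an arity and a coarity in $\mathcal S^\star$). Monomials are words $U\in\mathcal S^\star$ (with empty word $1$); polynomials are words $P\in(\mathcal S^\star)^\star$ of monomials, written $U_1\oplus\dots\oplus U_n$ (with empty word $0$). Circuits $c\colon U\to V$ are built from the symbols of $\Sigma$, identities and symmetries by composition $;$ and product $\otimes$, together with, for every sort $A$, a copier $A\to A\otimes A$, a discharger $A\to 1$, a cocopier $A\otimes A\to A$ and a codischarger $1\to A$. Tapes $P\to Q$ are built from circuits (seen as tapes between monomials), identities and symmetries of $\oplus$ by composition $;$ and sum $\oplus$, together with, for every monomial $U$, the arrows $\Delta_U\colon U\to U\oplus U$, $U\to 0$, $\nabla_U\colon U\oplus U\to U$, $0\to U$, and the trace $\mathsf{tr}_U$ sending $U\oplus P\to U\oplus Q$ to $P\to Q$. All constants and the trace are extended to monomials and polynomials in the standard way, and the product $\otimes$ of tapes is the derived one, defined by whiskerings and distributors. For $t\colon U\to U$, $t^*=\mathsf{tr}_U((t\oplus \mathrm{id}_U);\nabla_U;\Delta_U)$.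 For a circuit $c\colon U\to V$, $c^\dagger\colon V\to U$ is its converse, obtained by bending wires with the (co)copiers and (co)dischargers; for tapes, $(-)^\dagger$ commutes with $\oplus$, reverses composition, and exchanges $\nabla$ with $\Delta$. **Theories.** A *kc theory* $(\Sigma,\mathbb I)$ is a monoidal signature together with a set $\mathbb I$ of pairs $(t_1,t_2)$ of tapes with the same domain and codomain. Its order $\le_{\mathbb I}$ is the least family of preorders on the sets of tapes $P\to Q$ that contains $\mathbb I$ and the axioms below, is closed under $;$, $\oplus$ and $\otimes$, and is closed under the two posetal uniformity rules: for $t_i\colon S_i\oplus P\to S_i\oplus Q$ $(i=1,2)$, * if $s_2\le s_1\colon S_1\to S_2$ and $t_1;(s_1\oplus\mathrm{id}_Q)\le(s_2\oplus\mathrm{id}_P);t_2$, then $\mathsf{tr}_{S_1}t_1\le\mathsf{tr}_{S_2}t_2$; * if $s_2\le s_1\colon S_2\to S_1$ and $(s_1\oplus\mathrm{id}_P);t_1\le t_2;(s_2\oplus\mathrm{id}_Q)$, then $\mathsf{tr}_{S_1}t_1\le\mathsf{tr}_{S_2}t_2$. The axioms are those of kc-rig categories: the laws of strict symmetric monoidal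 categories for $\otimes$ (on circuits) and for $\oplus$ (on tapes); functoriality of the embedding of circuits into tapes; the laws of the trace; for every sort, (co)copier and (co)discharger form a special commutative Frobenius bimonoid, the comonoid being left adjoint to the monoid, and the copiers and dischargers are lax natural with respect to the symbols of $\Sigma$; for every monomial, the (co)monoid structures of $\oplus$ form a commutative bimonoid, natural with respect to circuits, the monoid being left adjoint to the comonoid; and $\mathsf{tr}_U(\nabla_U;\Delta_U)=\mathrm{id}_U$. The category $\mathbf{KCT}_{\Sigma,\mathbb I}$ has polynomials as objects and, as arrows $P\to Q$, tapes $P\to Q$ modulo $\le_{\mathbb I}\cap\ge_{\mathbb I}$, ordered by $\le_{\mathbb I}$. **The Peano theory.** This is the kc theory $(\Sigma,\mathbb P)$ with a single sort $A$, with $\Sigma=\{0\colon 1\to A,\ s\colon A\to A\}$ and, writing $[s,0]=(s\oplus 0);\nabla_A\colon A\oplus 1\to A$ and $\top\colon 1\to A$ for the codischarger of $A$, with $\mathbb P$ consisting of $$[s,0]^\dagger;[s,0]=\mathrm{id}_A,\qquad [s,0];[s,0]^\dagger=\mathrm{id}_{A\oplus 1},\qquad \top\le 0;s^*$$ (each equation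 standing for two inequations). **Theorem 7.1 (Principle of Induction).** Let $(\Pi,\mathbb Q)$ be a kc theory extending the Peano theory, that is, $\Sigma\subseteq\Pi$ and $\mathbb P\subseteq\mathbb Q$. Then for every arrow $P\colon 1\to A$ of $\mathbf{KCT}_{\Pi,\mathbb Q}$, $$\text{if}\quad 0\le_{\mathbb Q}P\quad\text{and}\quad P;s\le_{\mathbb Q}P,\quad\text{then}\quad \top\le_{\mathbb Q}P .$$ -/

import Mathlib

open CategoryTheory

universe u v u₁ v₁ u₂ v₂

/-! ### Signatures, monomials, polynomials -/

/-- A monoidal signature: sorts, symbols, and an arity and a coarity (words of sorts) for each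
symbol. -/
structure MonSig where
  sorts : Type u
  symbols : Type v
  ar : symbols → List sorts
  coar : symbols → List sorts

/-- Monomials: words over the sorts.  The empty word is the unit `1` of the product. -/
abbrev Monom (Γ : MonSig.{u, v}) := List Γ.sorts

/-- (Non-commutative) polynomials: words of words.  The empty word of words is the zero object,
and concatenation is the sum of objects. -/
abbrev Polyn (Γ : MonSig.{u, v}) := List (Monom Γ)

/-- The product of a monomial with a polynomial. -/
def Polyn.lmul {Γ : MonSig.{u, v}} (U : Monom Γ) (Q : Polyn Γ) : Polyn Γ := Q.map fun V => U ++ V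

/-- The product of polynomials: the sum over `i`, then over `j`, of the words `Uᵢ Vⱼ`. -/
def Polyn.mul {Γ : MonSig.{u, v}} (P Q : Polyn Γ) : Polyn Γ := P.flatMap fun U => Polyn.lmul U Q

/-! ### Circuits: the first layer of terms -/

/-- Raw circuits.  `seq` is composition in diagrammatic order, `par` the monoidal product. -/
inductive Circ (Γ : MonSig.{u, v}) : Type (max u v)
  | id (A : Γ.sorts)
  | idOne
  | gen (s : Γ.symbols)
  | symm (A B : Γ.sorts)
  | seq (c d : Circ Γ)
  | par (c d : Circ Γ)
  | discharger (A : Γ.sorts)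
  | copier (A : Γ.sorts)
  | codischarger (A : Γ.sorts)
  | cocopier (A : Γ.sorts)

namespace Circ

variable {Γ : MonSig.{u, v}}

/-- Typing of circuits: `c.HasType U V` means `c : U → V`. -/
inductive HasType : Circ Γ → Monom Γ → Monom Γ → Prop
  | id (A) : HasType (id A) [A] [A]
  | idOne : HasType idOne [] []
  | gen (s) : HasType (gen s) (Γ.ar s) (Γ.coar s)
  | symm (A B) : HasType (symm A B) [A, B] [B, A]
  | seq {c d U V W} : HasType c U V → HasType d V W → HasType (seq c d) U W
  | par {c d U₁ V₁ U₂ V₂} : HasType c U₁ V₁ → HasType d U₂ V₂ →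
      HasType (par c d) (U₁ ++ U₂) (V₁ ++ V₂)
  | discharger (A) : HasType (discharger A) [A] []
  | copier (A) : HasType (copier A) [A] [A, A]
  | codischarger (A) : HasType (codischarger A) [] [A]
  | cocopier (A) : HasType (cocopier A) [A, A] [A]

/-- The identity circuit of a monomial. -/
def idW : Monom Γ → Circ Γ
  | [] => idOne
  | A :: U => (id A).par (idW U)

/-- The symmetry `A V → V A`, for a sort `A` and a monomial `V`. -/
def symmS (A : Γ.sorts) : Monom Γ → Circ Γ
  | [] => id A
  | B :: V => ((symm A B).par (idW V)).seq ((id B).par (symmS A V))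

/-- The symmetry `U V → V U` of two monomials. -/
def symmW : Monom Γ → Monom Γ → Circ Γ
  | [], V => idW V
  | A :: U, V => ((id A).par (symmW U V)).seq ((symmS A V).par (idW U))

/-- The copier `U → U U` of a monomial. -/
def copierW : Monom Γ → Circ Γ
  | [] => idOne
  | A :: U => ((copier A).par (copierW U)).seq (((id A).par (symmW [A] U)).par (idW U))

/-- The discharger `U → 1` of a monomial. -/
def dischargerW : Monom Γ → Circ Γ
  | [] => idOne
  | A :: U => (discharger A).par (dischargerW U)

/-- The cocopier `U U → U` of a monomial. -/
def cocopierW : Monom Γ → Circ Γ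
  | [] => idOne
  | A :: U => (((id A).par (symmW U [A])).par (idW U)).seq ((cocopier A).par (cocopierW U))

/-- The codischarger `1 → U` of a monomial. -/
def codischargerW : Monom Γ → Circ Γ
  | [] => idOne
  | A :: U => (codischarger A).par (codischargerW U)

/-- The converse `V → U` of a circuit `c : U → V`, obtained by bending wires. -/
def op (U V : Monom Γ) (c : Circ Γ) : Circ Γ :=
  (((idW V).par ((codischargerW U).seq (copierW U))).seq (((idW V).par c).par (idW U))).seq
    (((cocopierW V).seq (dischargerW V)).par (idW U))

theorem idW_hasType : ∀ U : Monom Γ, (idW U).HasType U U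
  | [] => .idOne
  | A :: U => .par (U₁ := [A]) (V₁ := [A]) (.id A) (idW_hasType U)

theorem symmS_hasType (A : Γ.sorts) : ∀ V : Monom Γ, (symmS A V).HasType (A :: V) (V ++ [A])
  | [] => .id A
  | B :: V => .seq (.par (U₁ := [A, B]) (V₁ := [B, A]) (.symm A B) (idW_hasType V))
      (.par (U₁ := [B]) (V₁ := [B]) (.id B) (symmS_hasType A V))

theorem symmW_hasType : ∀ U V : Monom Γ, (symmW U V).HasType (U ++ V) (V ++ U)
  | [], V => by simpa [symmW] using idW_hasType V
  | A :: U, V => by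
      have h := HasType.seq (.par (U₁ := [A]) (V₁ := [A]) (.id A) (symmW_hasType U V))
        (.par (U₁ := A :: V) (symmS_hasType A V) (idW_hasType U))
      simpa [symmW] using h

theorem copierW_hasType : ∀ U : Monom Γ, (copierW U).HasType U (U ++ U)
  | [] => .idOne
  | A :: U => by
      have h₁ := HasType.par (.copier A) (copierW_hasType U)
      have h₂ := HasType.par (.par (.id A) (symmW_hasType [A] U)) (idW_hasType U)
      simp only [List.cons_append, List.nil_append, List.append_assoc] at h₁ h₂
      exact .seq h₁ h₂

theorem cocopierW_hasType : ∀ U : Monom Γ, (cocopierW U).HasType (U ++ U) U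
  | [] => .idOne
  | A :: U => by
      have h₁ := HasType.par (.par (.id A) (symmW_hasType U [A])) (idW_hasType U)
      have h₂ := HasType.par (.cocopier A) (cocopierW_hasType U)
      simp only [List.cons_append, List.nil_append, List.append_assoc] at h₁ h₂
      exact .seq h₁ h₂

theorem dischargerW_hasType : ∀ U : Monom Γ, (dischargerW U).HasType U []
  | [] => .idOne
  | A :: U => .par (U₁ := [A]) (V₁ := []) (.discharger A) (dischargerW_hasType U)

theorem codischargerW_hasType : ∀ U : Monom Γ, (codischargerW U).HasType [] U
  | [] => .idOne
  | A :: U => .par (U₁ := []) (V₁ := [A]) (.codischarger A) (codischargerW_hasType U)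

theorem op_hasType {c : Circ Γ} {U V : Monom Γ} (h : c.HasType U V) : (op U V c).HasType V U := by
  have h₁ := HasType.par (idW_hasType V) (.seq (codischargerW_hasType U) (copierW_hasType U))
  have h₂ := HasType.par (.par (idW_hasType V) h) (idW_hasType U)
  have h₃ := HasType.par (.seq (cocopierW_hasType V) (dischargerW_hasType V)) (idW_hasType U)
  simp only [List.append_nil, List.nil_append, List.append_assoc] at h₁ h₂ h₃
  exact .seq (.seq h₁ h₂) h₃

end Circ

/-! ### Tapes: the second layer of terms -/

/-- Raw tapes.  `emb c` is the tape containing the circuit `c`, `seq` is composition in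
diagrammatic order, `plus` is the sum of tapes, `bang`, `diag`, `cobang`, `codiag` are the
(co)monoids of the sum, and `tr` is the trace. -/
inductive Tape (Γ : MonSig.{u, v}) : Type (max u v)
  | id (U : Monom Γ)
  | idZero
  | emb (c : Circ Γ)
  | symm (U V : Monom Γ)
  | seq (t s : Tape Γ)
  | plus (t s : Tape Γ)
  | bang (U : Monom Γ)
  | diag (U : Monom Γ)
  | cobang (U : Monom Γ)
  | codiag (U : Monom Γ)
  | tr (U : Monom Γ) (t : Tape Γ)

namespace Tape

variable {Γ : MonSig.{u, v}}

/-- Typing of tapes: `t.HasType P Q` means `t : P → Q`. -/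
inductive HasType : Tape Γ → Polyn Γ → Polyn Γ → Prop
  | id (U) : HasType (id U) [U] [U]
  | idZero : HasType idZero [] []
  | emb {c U V} : c.HasType U V → HasType (emb c) [U] [V]
  | symm (U V) : HasType (symm U V) [U, V] [V, U]
  | seq {t s P Q R} : HasType t P Q → HasType s Q R → HasType (seq t s) P R
  | plus {t s P₁ Q₁ P₂ Q₂} : HasType t P₁ Q₁ → HasType s P₂ Q₂ →
      HasType (plus t s) (P₁ ++ P₂) (Q₁ ++ Q₂)
  | bang (U) : HasType (bang U) [U] []
  | diag (U) : HasType (diag U) [U] [U, U]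
  | cobang (U) : HasType (cobang U) [] [U]
  | codiag (U) : HasType (codiag U) [U, U] [U]
  | tr {U t P Q} : HasType t (U :: P) (U :: Q) → HasType (tr U t) P Q

/-! Extension of the constants and of the trace from monomials to polynomials. -/

/-- The identity of a polynomial. -/
def idP : Polyn Γ → Tape Γ
  | [] => idZero
  | U :: P => (id U).plus (idP P)

/-- The additive symmetry `U ⊕ Q → Q ⊕ U`, for a monomial `U` and a polynomial `Q`. -/
def symmM (U : Monom Γ) : Polyn Γ → Tape Γ
  | [] => id U
  | V :: Q => ((symm U V).plus (idP Q)).seq ((id V).plus (symmM U Q))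

/-- The additive symmetry `P ⊕ Q → Q ⊕ P` of two polynomials. -/
def symmP : Polyn Γ → Polyn Γ → Tape Γ
  | [], Q => idP Q
  | U :: P, Q => ((id U).plus (symmP P Q)).seq ((symmM U Q).plus (idP P))

/-- The diagonal `P → P ⊕ P` of a polynomial. -/
def diagP : Polyn Γ → Tape Γ
  | [] => idZero
  | U :: P => ((diag U).plus (diagP P)).seq (((id U).plus (symmP [U] P)).plus (idP P))

/-- The bang `P → 0` of a polynomial. -/
def bangP : Polyn Γ → Tape Γ
  | [] => idZero
  | U :: P => (bang U).plus (bangP P)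

/-- The cobang `0 → P` of a polynomial. -/
def cobangP : Polyn Γ → Tape Γ
  | [] => idZero
  | U :: P => (cobang U).plus (cobangP P)

/-- The trace along a polynomial. -/
def trP : Polyn Γ → Tape Γ → Tape Γ
  | [], t => t
  | U :: P, t => trP P (tr U t)

/-! The product of tapes, through whiskerings and left distributors. -/

/-- Left whiskering by a monomial. -/
def lw (U : Monom Γ) : Tape Γ → Tape Γ
  | id V => id (U ++ V)
  | idZero => idZero
  | emb c => emb ((Circ.idW U).par c)
  | symm V W => symm (U ++ V) (U ++ W)
  | seq t s => (lw U t).seq (lw U s)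
  | plus t s => (lw U t).plus (lw U s)
  | bang V => bang (U ++ V)
  | diag V => diag (U ++ V)
  | cobang V => cobang (U ++ V)
  | codiag V => codiag (U ++ V)
  | tr V t => tr (U ++ V) (lw U t)

/-- Right whiskering by a monomial. -/
def rw (U : Monom Γ) : Tape Γ → Tape Γ
  | id V => id (V ++ U)
  | idZero => idZero
  | emb c => emb (c.par (Circ.idW U))
  | symm V W => symm (V ++ U) (W ++ U)
  | seq t s => (rw U t).seq (rw U s)
  | plus t s => (rw U t).plus (rw U s)
  | bang V => bang (V ++ U)
  | diag V => diag (V ++ U)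
  | cobang V => cobang (V ++ U)
  | codiag V => codiag (V ++ U)
  | tr V t => tr (V ++ U) (rw U t)

/-- The left distributor `P (Q ⊕ R) → P Q ⊕ P R`. -/
def dl : Polyn Γ → Polyn Γ → Polyn Γ → Tape Γ
  | [], _, _ => idZero
  | U :: P, Q, R => ((idP (Polyn.lmul U (Q ++ R))).plus (dl P Q R)).seq
      (((idP (Polyn.lmul U Q)).plus
          (symmP (Polyn.lmul U R) (Polyn.mul P Q))).plus (idP (Polyn.mul P R)))

/-- The inverse `P Q ⊕ P R → P (Q ⊕ R)` of the left distributor. -/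
def dlInv : Polyn Γ → Polyn Γ → Polyn Γ → Tape Γ
  | [], _, _ => idZero
  | U :: P, Q, R =>
      (((idP (Polyn.lmul U Q)).plus
          (symmP (Polyn.mul P Q) (Polyn.lmul U R))).plus (idP (Polyn.mul P R))).seq
        ((idP (Polyn.lmul U (Q ++ R))).plus (dlInv P Q R))

/-- Left whiskering by a polynomial. -/
def lwP : Polyn Γ → Tape Γ → Tape Γ
  | [], _ => idZero
  | W :: S, t => (lw W t).plus (lwP S t)

/-- Right whiskering by a polynomial `S` of a tape `t : P → Q`. -/
def rwP (P Q : Polyn Γ) : Polyn Γ → Tape Γ → Tape Γ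
  | [], _ => idZero
  | W :: S, t => ((dl P [W] S).seq ((rw W t).plus (rwP P Q S t))).seq (dlInv Q [W] S)

/-- The product of `t : P → Q` and `s : R → S`; its type is `P R → Q S`. -/
def tensor (P Q S : Polyn Γ) (t s : Tape Γ) : Tape Γ := (lwP P s).seq (rwP P Q S t)

/-- The Kleene star of a tape `t : U → U` on a monomial `U`. -/
def star (U : Monom Γ) (t : Tape Γ) : Tape Γ :=
  tr U (((t.plus (id U)).seq (codiag U)).seq (diag U))

end Tape

/-! ### The axioms of kc-rig categories, and the precongruence they generate -/

section Axioms

variable {Γ : MonSig.{u, v}}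

/-- Equations between circuits: the laws of strict symmetric monoidal categories, and the special
Frobenius bimonoid equations for the copiers. -/
inductive CircEq : Circ Γ → Circ Γ → Prop
  | assoc {f g h : Circ Γ} {U V W X : Monom Γ} : f.HasType U V → g.HasType V W → h.HasType W X →
      CircEq ((f.seq g).seq h) (f.seq (g.seq h))
  | id_seq {f : Circ Γ} {U V : Monom Γ} : f.HasType U V → CircEq ((Circ.idW U).seq f) f
  | seq_id {f : Circ Γ} {U V : Monom Γ} : f.HasType U V → CircEq (f.seq (Circ.idW V)) f
  | interchange {f₁ f₂ g₁ g₂ : Circ Γ} {U₁ V₁ W₁ U₂ V₂ W₂ : Monom Γ} : f₁.HasType U₁ V₁ →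
      f₂.HasType U₂ V₂ →
      g₁.HasType V₁ W₁ → g₂.HasType V₂ W₂ →
      CircEq ((f₁.par f₂).seq (g₁.par g₂)) ((f₁.seq g₁).par (f₂.seq g₂))
  | one_par {f : Circ Γ} {U V : Monom Γ} : f.HasType U V → CircEq (Circ.idOne.par f) f
  | par_one {f : Circ Γ} {U V : Monom Γ} : f.HasType U V → CircEq (f.par Circ.idOne) f
  | par_assoc {f g h : Circ Γ} {U₁ V₁ U₂ V₂ U₃ V₃ : Monom Γ} : f.HasType U₁ V₁ →
      g.HasType U₂ V₂ → h.HasType U₃ V₃ →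
      CircEq ((f.par g).par h) (f.par (g.par h))
  | symm_inv (U V : Monom Γ) :
      CircEq ((Circ.symmW U V).seq (Circ.symmW V U)) (Circ.idW (U ++ V))
  | symm_nat {s : Circ Γ} {X Y : Monom Γ} (Z : Monom Γ) : s.HasType X Y →
      CircEq ((s.par (Circ.idW Z)).seq (Circ.symmW Y Z))
        ((Circ.symmW X Z).seq ((Circ.idW Z).par s))
  | copier_assoc (A : Γ.sorts) : CircEq ((Circ.copier A).seq ((Circ.id A).par (Circ.copier A)))
      ((Circ.copier A).seq ((Circ.copier A).par (Circ.id A)))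
  | copier_unit (A : Γ.sorts) : CircEq ((Circ.copier A).seq ((Circ.discharger A).par (Circ.id A)))
      (Circ.id A)
  | copier_comm (A : Γ.sorts) : CircEq ((Circ.copier A).seq (Circ.symm A A)) (Circ.copier A)
  | cocopier_assoc (A : Γ.sorts) : CircEq (((Circ.id A).par
      (Circ.cocopier A)).seq (Circ.cocopier A))
      (((Circ.cocopier A).par (Circ.id A)).seq (Circ.cocopier A))
  | cocopier_unit (A : Γ.sorts) :
      CircEq (((Circ.codischarger A).par (Circ.id A)).seq (Circ.cocopier A))
      (Circ.id A)
  | cocopier_comm (A : Γ.sorts) : CircEq ((Circ.symm A A).seq (Circ.cocopier A)) (Circ.cocopier A)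
  | frobenius (A : Γ.sorts) :
      CircEq (((Circ.id A).par (Circ.copier A)).seq ((Circ.cocopier A).par (Circ.id A)))
        ((Circ.cocopier A).seq (Circ.copier A))
  | special (A : Γ.sorts) : CircEq (Circ.id A) ((Circ.copier A).seq (Circ.cocopier A))

/-- Inequations between circuits: lax naturality of the copiers and dischargers for the symbols of
the signature, and adjointness. -/
inductive CircLe : Circ Γ → Circ Γ → Prop
  | copier_nat (s : Γ.symbols) : CircLe ((Circ.gen s).seq (Circ.copierW (Γ.coar s)))
      ((Circ.copierW (Γ.ar s)).seq ((Circ.gen s).par (Circ.gen s)))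
  | discharger_nat (s : Γ.symbols) : CircLe ((Circ.gen s).seq (Circ.dischargerW (Γ.coar s)))
      (Circ.dischargerW (Γ.ar s))
  | copier_cocopier (A : Γ.sorts) : CircLe (Circ.id A) ((Circ.copier A).seq (Circ.cocopier A))
  | cocopier_copier (A : Γ.sorts) : CircLe ((Circ.cocopier A).seq (Circ.copier A)) (Circ.idW [A, A])
  | discharger_codischarger (A : Γ.sorts) :
      CircLe (Circ.id A) ((Circ.discharger A).seq (Circ.codischarger A))
  | codischarger_discharger (A : Γ.sorts) :
      CircLe ((Circ.codischarger A).seq (Circ.discharger A)) Circ.idOne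

/-- Equations between tapes: the laws of strict symmetric monoidal categories for the sum, the
trace laws (joining and vanishing hold by definition of `Tape.trP`), the bimonoid laws of the sum
and their naturality with respect to circuits, the trace of `codiag ; diag`, and functoriality of
the embedding of circuits. -/
inductive TapeEq : Tape Γ → Tape Γ → Prop
  | circ {c d : Circ Γ} : CircEq c d → TapeEq (Tape.emb c) (Tape.emb d)
  | assoc {f g h : Tape Γ} {P Q R S : Polyn Γ} : f.HasType P Q → g.HasType Q R → h.HasType R S →
      TapeEq ((f.seq g).seq h) (f.seq (g.seq h))
  | id_seq {f : Tape Γ} {P Q : Polyn Γ} : f.HasType P Q → TapeEq ((Tape.idP P).seq f) f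
  | seq_id {f : Tape Γ} {P Q : Polyn Γ} : f.HasType P Q → TapeEq (f.seq (Tape.idP Q)) f
  | interchange {f₁ f₂ g₁ g₂ : Tape Γ} {P₁ Q₁ R₁ P₂ Q₂ R₂ : Polyn Γ} : f₁.HasType P₁ Q₁ →
      f₂.HasType P₂ Q₂ →
      g₁.HasType Q₁ R₁ → g₂.HasType Q₂ R₂ →
      TapeEq ((f₁.plus f₂).seq (g₁.plus g₂)) ((f₁.seq g₁).plus (f₂.seq g₂))
  | zero_plus {f : Tape Γ} {P Q : Polyn Γ} : f.HasType P Q → TapeEq (Tape.idZero.plus f) f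
  | plus_zero {f : Tape Γ} {P Q : Polyn Γ} : f.HasType P Q → TapeEq (f.plus Tape.idZero) f
  | plus_assoc {f g h : Tape Γ} {P₁ Q₁ P₂ Q₂ P₃ Q₃ : Polyn Γ} : f.HasType P₁ Q₁ → g.HasType P₂ Q₂ →
      h.HasType P₃ Q₃ → TapeEq ((f.plus g).plus h) (f.plus (g.plus h))
  | symm_inv (P Q : Polyn Γ) :
      TapeEq ((Tape.symmP P Q).seq (Tape.symmP Q P)) (Tape.idP (P ++ Q))
  | symm_nat {t : Tape Γ} {P Q : Polyn Γ} (R : Polyn Γ) : t.HasType P Q →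
      TapeEq ((t.plus (Tape.idP R)).seq (Tape.symmP Q R))
        ((Tape.symmP P R).seq ((Tape.idP R).plus t))
  | tightening {t r w : Tape Γ} {U : Monom Γ} {P' P Q Q' : Polyn Γ} : r.HasType P' P →
      t.HasType (U :: P) (U :: Q) →
      w.HasType Q Q' →
      TapeEq (Tape.tr U ((((Tape.id U).plus r).seq t).seq ((Tape.id U).plus w)))
        ((r.seq (Tape.tr U t)).seq w)
  | strength {t s : Tape Γ} {U : Monom Γ} {P Q P' Q' : Polyn Γ} : t.HasType (U :: P) (U :: Q) →
      s.HasType P' Q' →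
      TapeEq (Tape.tr U (t.plus s)) ((Tape.tr U t).plus s)
  | sliding {t r : Tape Γ} {U V : Monom Γ} {P Q : Polyn Γ} : t.HasType (V :: P) (U :: Q) →
      r.HasType [U] [V] →
      TapeEq (Tape.tr V (t.seq (r.plus (Tape.idP Q))))
        (Tape.tr U ((r.plus (Tape.idP P)).seq t))
  | yanking (U : Monom Γ) : TapeEq (Tape.tr U (Tape.symm U U)) (Tape.id U)
  | diag_assoc (U : Monom Γ) : TapeEq ((Tape.diag U).seq ((Tape.id U).plus (Tape.diag U)))
      ((Tape.diag U).seq ((Tape.diag U).plus (Tape.id U)))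
  | diag_unit (U : Monom Γ) : TapeEq ((Tape.diag U).seq ((Tape.bang U).plus
      (Tape.id U))) (Tape.id U)
  | diag_comm (U : Monom Γ) : TapeEq ((Tape.diag U).seq (Tape.symm U U)) (Tape.diag U)
  | codiag_assoc (U : Monom Γ) : TapeEq (((Tape.id U).plus (Tape.codiag U)).seq (Tape.codiag U))
      (((Tape.codiag U).plus (Tape.id U)).seq (Tape.codiag U))
  | codiag_unit (U : Monom Γ) : TapeEq (((Tape.cobang U).plus (Tape.id U)).seq (Tape.codiag U))
      (Tape.id U)
  | codiag_comm (U : Monom Γ) : TapeEq ((Tape.symm U U).seq (Tape.codiag U)) (Tape.codiag U)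
  | bi (U : Monom Γ) : TapeEq ((Tape.codiag U).seq (Tape.diag U))
      ((Tape.diagP [U, U]).seq ((Tape.codiag U).plus (Tape.codiag U)))
  | bo (U : Monom Γ) : TapeEq ((Tape.cobang U).seq (Tape.bang U)) Tape.idZero
  | cobang_diag (U : Monom Γ) : TapeEq ((Tape.cobang U).seq (Tape.diag U)) (Tape.cobangP [U, U])
  | codiag_bang (U : Monom Γ) : TapeEq ((Tape.codiag U).seq (Tape.bang U)) (Tape.bangP [U, U])
  | bang_nat {c : Circ Γ} {U V : Monom Γ} : c.HasType U V →
      TapeEq ((Tape.emb c).seq (Tape.bang V)) (Tape.bang U)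
  | diag_nat {c : Circ Γ} {U V : Monom Γ} : c.HasType U V → TapeEq ((Tape.emb c).seq (Tape.diag V))
      ((Tape.diag U).seq ((Tape.emb c).plus (Tape.emb c)))
  | cobang_nat {c : Circ Γ} {U V : Monom Γ} : c.HasType U V →
      TapeEq ((Tape.cobang U).seq (Tape.emb c)) (Tape.cobang V)
  | codiag_nat {c : Circ Γ} {U V : Monom Γ} : c.HasType U V →
      TapeEq ((Tape.codiag U).seq (Tape.emb c))
      (((Tape.emb c).plus (Tape.emb c)).seq (Tape.codiag V))
  | tr_codiag_diag (U : Monom Γ) :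
      TapeEq (Tape.tr U ((Tape.codiag U).seq (Tape.diag U))) (Tape.id U)
  | emb_id (U : Monom Γ) : TapeEq (Tape.emb (Circ.idW U)) (Tape.id U)
  | emb_seq {c d : Circ Γ} {U V W : Monom Γ} : c.HasType U V → d.HasType V W →
      TapeEq (Tape.emb (c.seq d)) ((Tape.emb c).seq (Tape.emb d))

/-- Inequations between tapes: those of circuits, and adjointness for the sum. -/
inductive TapeLe : Tape Γ → Tape Γ → Prop
  | circ {c d : Circ Γ} : CircLe c d → TapeLe (Tape.emb c) (Tape.emb d)
  | diag_codiag (U : Monom Γ) : TapeLe ((Tape.diag U).seq (Tape.codiag U)) (Tape.id U)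
  | codiag_diag (U : Monom Γ) : TapeLe (Tape.idP [U, U]) ((Tape.codiag U).seq (Tape.diag U))
  | bang_cobang (U : Monom Γ) : TapeLe ((Tape.bang U).seq (Tape.cobang U)) (Tape.id U)
  | cobang_bang (U : Monom Γ) : TapeLe Tape.idZero ((Tape.cobang U).seq (Tape.bang U))

variable (Γ) in
/-- The set of pairs of tapes containing the axioms of kc-rig categories. -/
def kcAxioms : Set (Tape Γ × Tape Γ) :=
  {p | TapeEq p.1 p.2 ∨ TapeEq p.2 p.1 ∨ TapeLe p.1 p.2}

/-- `Precong I P Q t s`: the pair `(t, s)` of tapes of type `P → Q` is in the precongruence (for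
composition, sum and product) generated by the pairs in `I` and closed under the two posetal
uniformity rules for the trace. -/
inductive Precong (I : Set (Tape Γ × Tape Γ)) : Polyn Γ → Polyn Γ → Tape Γ → Tape Γ → Prop
  | ax {t₁ t₂ : Tape Γ} {P Q : Polyn Γ} : (t₁, t₂) ∈ I → t₁.HasType P Q → t₂.HasType P Q →
      Precong I P Q t₁ t₂
  | refl {t : Tape Γ} {P Q : Polyn Γ} : t.HasType P Q → Precong I P Q t t
  | trans {t₁ t₂ t₃ : Tape Γ} {P Q : Polyn Γ} : Precong I P Q t₁ t₂ → Precong I P Q t₂ t₃ →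
      Precong I P Q t₁ t₃
  | seq {t₁ t₂ s₁ s₂ : Tape Γ} {P Q R : Polyn Γ} : Precong I P Q t₁ t₂ → Precong I Q R s₁ s₂ →
      Precong I P R (t₁.seq s₁) (t₂.seq s₂)
  | plus {t₁ t₂ s₁ s₂ : Tape Γ} {P Q P' Q' : Polyn Γ} : Precong I P Q t₁ t₂ →
      Precong I P' Q' s₁ s₂ →
      Precong I (P ++ P') (Q ++ Q') (t₁.plus s₁) (t₂.plus s₂)
  | tensor {t₁ t₂ s₁ s₂ : Tape Γ} {P Q R S : Polyn Γ} : Precong I P Q t₁ t₂ → Precong I R S s₁ s₂ →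
      Precong I (Polyn.mul P R) (Polyn.mul Q S) (Tape.tensor P Q S t₁ s₁) (Tape.tensor P Q S t₂ s₂)
  | unif_right {t₁ t₂ s₁ s₂ : Tape Γ} {P Q S₁ S₂ : Polyn Γ} :
      t₁.HasType (S₁ ++ P) (S₁ ++ Q) → t₂.HasType (S₂ ++ P) (S₂ ++ Q) →
      Precong I S₁ S₂ s₂ s₁ →
      Precong I (S₁ ++ P) (S₂ ++ Q) (t₁.seq (s₁.plus (Tape.idP Q)))
        ((s₂.plus (Tape.idP P)).seq t₂) →
      Precong I P Q (Tape.trP S₁ t₁) (Tape.trP S₂ t₂)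
  | unif_left {t₁ t₂ s₁ s₂ : Tape Γ} {P Q S₁ S₂ : Polyn Γ} :
      t₁.HasType (S₁ ++ P) (S₁ ++ Q) → t₂.HasType (S₂ ++ P) (S₂ ++ Q) →
      Precong I S₂ S₁ s₂ s₁ →
      Precong I (S₂ ++ P) (S₁ ++ Q) ((s₁.plus (Tape.idP P)).seq t₁)
        (t₂.seq (s₂.plus (Tape.idP Q))) →
      Precong I P Q (Tape.trP S₁ t₁) (Tape.trP S₂ t₂)

end Axioms

/-! ### Kleene-Cartesian theories and the categories they generate -/

/-- A Kleene-Cartesian theory: a monoidal signature and a set of pairs of tapes with the same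
domain and codomain; a pair `(t, s)` stands for the inequation `t ≤ s`. -/
structure KCTheory where
  sig : MonSig.{u, v}
  ax : Set (Tape sig × Tape sig)
  ax_typed : ∀ p ∈ ax, ∃ P Q, p.1.HasType P Q ∧ p.2.HasType P Q

/-- The order on tapes of type `P → Q` in a theory. -/
def KCTheory.Le (T : KCTheory.{u, v}) (P Q : Polyn T.sig) (t s : Tape T.sig) : Prop :=
  Precong (kcAxioms T.sig ∪ T.ax) P Q t s

/-- The tapes of type `P → Q`, preordered by the theory `T`. -/
def TypedTape (T : KCTheory.{u, v}) (P Q : Polyn T.sig) : Type (max u v) :=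
  {t : Tape T.sig // t.HasType P Q}

instance (T : KCTheory.{u, v}) (P Q : Polyn T.sig) : Preorder (TypedTape T P Q) where
  le t s := T.Le P Q t.1 s.1
  le_refl t := Precong.refl t.2
  le_trans _ _ _ h₁ h₂ := Precong.trans h₁ h₂

/-- The category of Kleene-Cartesian tapes of a theory; its objects are polynomials. -/
structure KCT (T : KCTheory.{u, v}) where
  poly : Polyn T.sig

namespace KCT

variable {T : KCTheory.{u, v}}

/-- Arrows: tapes modulo the equivalence induced by the preorder. -/
def Hom (X Y : KCT T) : Type (max u v) :=
  Antisymmetrization (TypedTape T X.poly Y.poly) (· ≤ ·)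

theorem idP_hasType {Γ : MonSig.{u, v}} : ∀ P : Polyn Γ, (Tape.idP P).HasType P P
  | [] => .idZero
  | U :: P => .plus (P₁ := [U]) (Q₁ := [U]) (.id U) (idP_hasType P)

/-- The arrow represented by a tape. -/
def arrowOf {P Q : Polyn T.sig} (t : Tape T.sig) (h : t.HasType P Q) : Hom (⟨P⟩ : KCT T) ⟨Q⟩ :=
  toAntisymmetrization (· ≤ ·) (⟨t, h⟩ : TypedTape T P Q)

/-- Composition of arrows. -/
def comp {X Y Z : KCT T} : Hom X Y → Hom Y Z → Hom X Z :=
  Quotient.map₂ (fun t s => ⟨t.1.seq s.1, .seq t.2 s.2⟩)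
    fun _ _ h _ _ k => ⟨Precong.seq h.1 k.1, Precong.seq h.2 k.2⟩

theorem sound {P Q : Polyn T.sig} {t s : Tape T.sig} (ht : t.HasType P Q) (hs : s.HasType P Q)
    (h : TapeEq t s) : arrowOf (T := T) t ht = arrowOf s hs :=
  Quotient.sound ⟨Precong.ax (Or.inl (Or.inl h)) ht hs,
    Precong.ax (Or.inl (Or.inr (Or.inl h))) hs ht⟩

instance : Category.{max u v} (KCT T) where
  Hom := Hom
  id X := arrowOf (Tape.idP X.poly) (idP_hasType _)
  comp := comp
  id_comp f := Quotient.inductionOn f fun t => sound _ t.2 (.id_seq t.2)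
  comp_id f := Quotient.inductionOn f fun t => sound _ t.2 (.seq_id t.2)
  assoc f g h := Quotient.inductionOn₃ f g h fun t s r =>
    sound _ (.seq t.2 (.seq s.2 r.2)) (.assoc t.2 s.2 r.2)

/-- Every homset carries the partial order induced by the theory. -/
instance (X Y : KCT T) : PartialOrder (X ⟶ Y) :=
  inferInstanceAs (PartialOrder (Antisymmetrization (TypedTape T X.poly Y.poly) (· ≤ ·)))

end KCT

/-! ### Inclusions of signatures and of theories -/

/-- An inclusion of monoidal signatures: injective on sorts and on symbols, and preserving
arities and coarities. -/
structure MonSig.Inclusion (Γ : MonSig.{u₁, v₁}) (Δ : MonSig.{u₂, v₂}) where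
  sort : Γ.sorts → Δ.sorts
  symbol : Γ.symbols → Δ.symbols
  sort_inj : Function.Injective sort
  symbol_inj : Function.Injective symbol
  ar_symbol : ∀ s, Δ.ar (symbol s) = (Γ.ar s).map sort
  coar_symbol : ∀ s, Δ.coar (symbol s) = (Γ.coar s).map sort

section Inclusion

variable {Γ : MonSig.{u₁, v₁}} {Δ : MonSig.{u₂, v₂}}

/-- A circuit over a signature, read over a larger one. -/
def Circ.map (i : Γ.Inclusion Δ) : Circ Γ → Circ Δ
  | .id A => .id (i.sort A)
  | .idOne => .idOne
  | .gen s => .gen (i.symbol s)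
  | .symm A B => .symm (i.sort A) (i.sort B)
  | .seq c d => .seq (c.map i) (d.map i)
  | .par c d => .par (c.map i) (d.map i)
  | .discharger A => .discharger (i.sort A)
  | .copier A => .copier (i.sort A)
  | .codischarger A => .codischarger (i.sort A)
  | .cocopier A => .cocopier (i.sort A)

/-- A tape over a signature, read over a larger one. -/
def Tape.map (i : Γ.Inclusion Δ) : Tape Γ → Tape Δ
  | .id U => .id (List.map i.sort U)
  | .idZero => .idZero
  | .emb c => .emb (c.map i)
  | .symm U V => .symm (List.map i.sort U) (List.map i.sort V)
  | .seq t s => .seq (t.map i) (s.map i)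
  | .plus t s => .plus (t.map i) (s.map i)
  | .bang U => .bang (List.map i.sort U)
  | .diag U => .diag (List.map i.sort U)
  | .cobang U => .cobang (List.map i.sort U)
  | .codiag U => .codiag (List.map i.sort U)
  | .tr U t => .tr (List.map i.sort U) (t.map i)

end Inclusion

/-- `T₀.Extension T`: the theory `T` extends `T₀`, that is, its signature and its set of axioms
include those of `T₀`. -/
structure KCTheory.Extension (T₀ : KCTheory.{u₁, v₁}) (T : KCTheory.{u₂, v₂}) extends
    MonSig.Inclusion T₀.sig T.sig where
  ax_mem : ∀ p ∈ T₀.ax, (p.1.map toInclusion, p.2.map toInclusion) ∈ T.ax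

/-! ### The theory of Peano -/

namespace Peano

/-- The symbols of the Peano theory. -/
inductive Symbol
  | zero
  | succ

/-- The single-sorted signature with `zero : 1 → A` and `succ : A → A`. -/
def sig : MonSig.{0, 0} where
  sorts := Unit
  symbols := Symbol
  ar
    | .zero => []
    | .succ => [()]
  coar
    | .zero => [()]
    | .succ => [()]

/-- The monomial consisting of the sort `A`. -/
def carrier : Monom sig := [()]

/-- The tape `zero : 1 → A`. -/
def zero : Tape sig := .emb (.gen .zero)

/-- The tape `succ : A → A`. -/
def succ : Tape sig := .emb (.gen .succ)

/-- The copairing `[succ, zero] : A ⊕ 1 → A`. -/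
def copair : Tape sig := (succ.plus zero).seq (.codiag carrier)

/-- The converse `A → A ⊕ 1` of the copairing, written as a tape of converses of symbols. -/
def copairOp : Tape sig :=
  (Tape.diag carrier).seq
    ((Tape.emb (Circ.op carrier carrier (.gen .succ))).plus
      (Tape.emb (Circ.op [] carrier (.gen .zero))))

/-- The axioms: the copairing and its converse are mutually inverse (two equations, each as two
inequations), and the whole carrier is below `zero ; succ*`. -/
def axs : Set (Tape sig × Tape sig) :=
  {(copairOp.seq copair, .id carrier), (.id carrier, copairOp.seq copair),
    (copair.seq copairOp, Tape.idP [carrier, []]), (Tape.idP [carrier, []], copair.seq copairOp),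
    (.emb (.codischarger ()), zero.seq (succ.star carrier))}

theorem zero_hasType : zero.HasType [[]] [carrier] :=
  .emb (Circ.HasType.gen (Γ := sig) Symbol.zero)

theorem succ_hasType : succ.HasType [carrier] [carrier] :=
  .emb (Circ.HasType.gen (Γ := sig) Symbol.succ)

theorem copair_hasType : copair.HasType [carrier, []] [carrier] :=
  .seq (.plus succ_hasType zero_hasType) (.codiag _)

theorem copairOp_hasType : copairOp.HasType [carrier] [carrier, []] :=
  .seq (.diag _) (.plus (P₁ := [carrier]) (Q₁ := [carrier])
    (.emb (Circ.op_hasType (Circ.HasType.gen (Γ := sig) Symbol.succ)))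
    (.emb (Circ.op_hasType (Circ.HasType.gen (Γ := sig) Symbol.zero))))

theorem axs_typed : ∀ p ∈ axs, ∃ P Q, p.1.HasType P Q ∧ p.2.HasType P Q := by
  rintro p (rfl | rfl | rfl | rfl | rfl)
  · exact ⟨_, _, .seq copairOp_hasType copair_hasType, .id _⟩
  · exact ⟨_, _, .id _, .seq copairOp_hasType copair_hasType⟩
  · exact ⟨_, _, .seq copair_hasType copairOp_hasType, KCT.idP_hasType _⟩
  · exact ⟨_, _, KCT.idP_hasType _, .seq copair_hasType copairOp_hasType⟩
  · exact ⟨_, _, .emb (.codischarger _), .seq zero_hasType (.tr (.seq (.seq (.plus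
      succ_hasType (.id _)) (.codiag _)) (.diag _)))⟩

/-- The Kleene-Cartesian theory of Peano. -/
def theory : KCTheory.{0, 0} where
  sig := sig
  ax := axs
  ax_typed := axs_typed

variable {T : KCTheory.{u, v}} (e : theory.Extension T)

/-- The unit object `1` of the category generated by an extension of the Peano theory. -/
def one (_ : theory.Extension T) : KCT T := ⟨[[]]⟩

/-- The carrier `A` in the category generated by an extension of the Peano theory. -/
def obj : KCT T := ⟨[[e.sort ()]]⟩

/-- The arrow `0 : 1 → A`. -/
def zeroArrow : one e ⟶ obj e :=
  KCT.arrowOf (.emb (.gen (e.symbol Symbol.zero))) (by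
    have h := Circ.HasType.gen (Γ := T.sig) (e.symbol Symbol.zero)
    rw [e.ar_symbol Symbol.zero, e.coar_symbol Symbol.zero] at h
    exact .emb h)

/-- The arrow `s : A → A`. -/
def succArrow : obj e ⟶ obj e :=
  KCT.arrowOf (.emb (.gen (e.symbol Symbol.succ))) (by
    have h := Circ.HasType.gen (Γ := T.sig) (e.symbol Symbol.succ)
    rw [e.ar_symbol Symbol.succ, e.coar_symbol Symbol.succ] at h
    exact .emb h)

/-- The top arrow `1 → A`, represented by the codischarger of `A`. -/
def topArrow : one e ⟶ obj e :=
  KCT.arrowOf (.emb (.codischarger (e.sort ()))) (.emb (.codischarger _))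

end Peano

/-! The axiom `⊤ ≤ 0 ; s*` reduces induction to the Kleene star rule `comp_star_le`: if `p ; f ≤ p`
then `p ; f* ≤ p`. With `0 ≤ P` and `P ; s ≤ P` this gives `⊤ ≤ 0 ; s* ≤ P ; s* ≤ P`.

For the star rule, tightening turns `p ; f*` into the trace over `U` of `(f ⊕ p) ; ∇ ; Δ`. Since `tr
(∇ ; Δ) = id`, the arrow `p` itself is the trace over `V` of `∇ ; Δ ; (id ⊕ p)`. Uniformity along `p
: V → U` compares the two traces. It asks for `(p ; f ⊕ p) ; ∇ ; Δ ≤ ∇ ; Δ ; (p ⊕ p)`, and since `p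
; f ≤ p` it is enough that `∇ ; Δ` is laxly natural with respect to `p`.

The axioms give naturality of `∇` and `Δ` only for circuits, whereas `p` is an arbitrary tape,
possibly containing traces. The main work is therefore `tensor_self_comp_mix_le`, an induction on
tapes in which `∇ ; Δ` is extended to polynomials as `mix`. Apart from traces, the generators are
handled by the symmetric monoidal and bimonoid laws. For a trace along `U`, two copies of the traced
tape become one trace along `U ⊕ U` (`trace_tensor_trace`), and uniformity along the endomorphism `∇
; Δ` of `U ⊕ U` transports the inequality through it (`trace_tensor_self_comp_le`).

The manipulations take place in `KCT T` regarded as a symmetric monoidal category under `⊕`, so that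
Mathlib's coherence lemmas apply. -/

namespace KCT

variable {T : KCTheory.{u, v}}

/-! ### Provable equality of tapes and representatives of arrows. -/

/-- Provable equality of tapes of type `P → Q`. -/
def Equal (T : KCTheory.{u, v}) (P Q : Polyn T.sig) (t s : Tape T.sig) : Prop :=
  T.Le P Q t s ∧ T.Le P Q s t

namespace Equal

variable {P Q R P' Q' : Polyn T.sig} {t s r t' s' : Tape T.sig}

theorem of_tapeEq (h : TapeEq t s) (ht : t.HasType P Q) (hs : s.HasType P Q) : Equal T P Q t s :=
  ⟨.ax (.inl (.inl h)) ht hs, .ax (.inl (.inr (.inl h))) hs ht⟩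

theorem refl (ht : t.HasType P Q) : Equal T P Q t t := ⟨.refl ht, .refl ht⟩

theorem trans (h : Equal T P Q t s) (k : Equal T P Q s r) : Equal T P Q t r :=
  ⟨.trans h.1 k.1, .trans k.2 h.2⟩

theorem seq (h : Equal T P Q t s) (k : Equal T Q R t' s') : Equal T P R (t.seq t') (s.seq s') :=
  ⟨.seq h.1 k.1, .seq h.2 k.2⟩

theorem plus (h : Equal T P Q t s) (k : Equal T P' Q' t' s') :
    Equal T (P ++ P') (Q ++ Q') (t.plus t') (s.plus s') :=
  ⟨.plus h.1 k.1, .plus h.2 k.2⟩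

theorem id_plus_id : ∀ P Q : Polyn T.sig,
    Equal T (P ++ Q) (P ++ Q) ((Tape.idP P).plus (Tape.idP Q)) (Tape.idP (P ++ Q))
  | [], Q => of_tapeEq (.zero_plus (idP_hasType Q)) (.plus (idP_hasType []) (idP_hasType Q))
      (idP_hasType Q)
  | U :: P, Q => (of_tapeEq (P := U :: P ++ Q) (Q := U :: P ++ Q)
      (.plus_assoc (.id U) (idP_hasType P) (idP_hasType Q))
      (.plus (idP_hasType (U :: P)) (idP_hasType Q))
      (.plus (P₁ := [U]) (Q₁ := [U]) (.id U) (.plus (idP_hasType P) (idP_hasType Q)))).trans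
      (plus (P := [U]) (Q := [U]) (refl (.id U)) (id_plus_id P Q))

end Equal

theorem arrowOf_eq {P Q : Polyn T.sig} {t s : Tape T.sig} {ht : t.HasType P Q} {hs : s.HasType P Q}
    (h : Equal T P Q t s) : arrowOf t ht = arrowOf s hs :=
  Quotient.sound h

/-- The arrow represented by a tape, with the objects as parameters. -/
abbrev ofTape (X Y : KCT T) (t : Tape T.sig) (h : t.HasType X.poly Y.poly) : X ⟶ Y := arrowOf t h

theorem exists_arrowOf {X Y : KCT T} (f : X ⟶ Y) :
    ∃ t, ∃ h : t.HasType X.poly Y.poly, arrowOf t h = f :=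
  Quotient.inductionOn f fun t => ⟨t.1, t.2, rfl⟩

/-! ### The symmetric monoidal structure of the sum -/

/-- The sum of arrows. -/
def sum {X Y X' Y' : KCT T} : (X ⟶ Y) → (X' ⟶ Y') →
    ((⟨X.poly ++ X'.poly⟩ : KCT T) ⟶ ⟨Y.poly ++ Y'.poly⟩) :=
  Quotient.map₂ (fun t s => ⟨t.1.plus s.1, .plus t.2 s.2⟩)
    fun _ _ h _ _ k => ⟨Precong.plus h.1 k.1, Precong.plus h.2 k.2⟩

/-- The identity, between two expressions of the same polynomial. -/
def castIso {P Q : Polyn T.sig} (h : P = Q) : (⟨P⟩ : KCT T) ≅ ⟨Q⟩ where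
  hom := arrowOf (Tape.idP P) (h ▸ idP_hasType P)
  inv := arrowOf (Tape.idP P) (h ▸ idP_hasType P)
  hom_inv_id := by subst h; exact Category.id_comp _
  inv_hom_id := by subst h; exact Category.id_comp _

theorem castIso_trans {P Q R : Polyn T.sig} (h : P = Q) (k : Q = R) :
    (castIso (T := T) h).hom ≫ (castIso k).hom = (castIso (h.trans k)).hom := by
  subst h; exact Category.id_comp _

theorem castIso_sum {P Q P' Q' : Polyn T.sig} (h : P = Q) (k : P' = Q') :
    sum (castIso (T := T) h).hom (castIso (T := T) k).hom =
      (castIso (congrArg₂ (· ++ ·) h k)).hom := by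
  subst h k
  exact arrowOf_eq (Equal.id_plus_id _ _)

theorem castIso_hom_comp {P P' Q : Polyn T.sig} (h : P = P') {t : Tape T.sig}
    (ht : t.HasType P' Q) :
    (castIso (T := T) h).hom ≫ (arrowOf t ht : (⟨P'⟩ : KCT T) ⟶ ⟨Q⟩) = arrowOf t (h ▸ ht) := by
  subst h; exact Category.id_comp _

theorem comp_castIso_hom {P Q Q' : Polyn T.sig} (h : Q = Q') {t : Tape T.sig}
    (ht : t.HasType P Q) :
    (arrowOf t ht : (⟨P⟩ : KCT T) ⟶ ⟨Q⟩) ≫ (castIso (T := T) h).hom = arrowOf t (h ▸ ht) := by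
  subst h; exact Category.comp_id _

/-- From here on `⊗` on `KCT T` denotes the sum `⊕`, with unit the zero object; the product of tapes
plays no role in the structure. Sums of objects are strictly associative only up to propositional
equality of lists, so the structural isomorphisms are the identities `castIso`. -/
instance : MonoidalCategoryStruct (KCT T) where
  tensorObj X Y := ⟨X.poly ++ Y.poly⟩
  tensorHom f g := sum f g
  whiskerLeft _ _ _ f := sum (𝟙 _) f
  whiskerRight f _ := sum f (𝟙 _)
  tensorUnit := ⟨[]⟩
  associator _ _ _ := castIso (List.append_assoc _ _ _)
  leftUnitor _ := castIso (List.nil_append _)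
  rightUnitor _ := castIso (List.append_nil _)

open MonoidalCategory

theorem castIso_tensor {P Q P' Q' : Polyn T.sig} (h : P = Q) (k : P' = Q') :
    ((castIso (T := T) h).hom ⊗ₘ (castIso (T := T) k).hom) =
      (castIso (congrArg₂ (· ++ ·) h k)).hom := castIso_sum h k

instance : MonoidalCategory (KCT T) := .ofTensorHom
  (id_tensorHom_id := fun _ _ => arrowOf_eq (Equal.id_plus_id _ _))
  (id_tensorHom := fun _ _ _ _ => rfl)
  (tensorHom_id := fun _ _ => rfl)
  (tensorHom_comp_tensorHom := fun f₁ f₂ g₁ g₂ => by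
    obtain ⟨t₁, h₁, rfl⟩ := exists_arrowOf f₁
    obtain ⟨t₂, h₂, rfl⟩ := exists_arrowOf f₂
    obtain ⟨s₁, k₁, rfl⟩ := exists_arrowOf g₁
    obtain ⟨s₂, k₂, rfl⟩ := exists_arrowOf g₂
    exact sound _ _ (.interchange h₁ h₂ k₁ k₂))
  (associator_naturality := fun f₁ f₂ f₃ => by
    obtain ⟨t₁, h₁, rfl⟩ := exists_arrowOf f₁
    obtain ⟨t₂, h₂, rfl⟩ := exists_arrowOf f₂
    obtain ⟨t₃, h₃, rfl⟩ := exists_arrowOf f₃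
    refine (comp_castIso_hom (List.append_assoc _ _ _) (.plus (.plus h₁ h₂) h₃)).trans
      (.trans ?_ (castIso_hom_comp (List.append_assoc _ _ _) (.plus h₁ (.plus h₂ h₃))).symm)
    exact sound _ _ (.plus_assoc h₁ h₂ h₃))
  (leftUnitor_naturality := fun f => by
    obtain ⟨t, h, rfl⟩ := exists_arrowOf f
    refine (comp_castIso_hom (List.nil_append _) (.plus (idP_hasType []) h)).trans
      (.trans ?_ (castIso_hom_comp (List.nil_append _) h).symm)
    exact sound _ _ (.zero_plus h))
  (rightUnitor_naturality := fun f => by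
    obtain ⟨t, h, rfl⟩ := exists_arrowOf f
    refine (comp_castIso_hom (List.append_nil _) (.plus h (idP_hasType []))).trans
      (.trans ?_ (castIso_hom_comp (List.append_nil _) h).symm)
    exact sound _ _ (.plus_zero h))
  (pentagon := fun W X Y Z => by
    have h₁ := castIso_tensor (T := T) (List.append_assoc W.poly X.poly Y.poly) (rfl : Z.poly = _)
    have h₂ := castIso_tensor (T := T) (rfl : W.poly = _) (List.append_assoc X.poly Y.poly Z.poly)
    refine (congrArg₂ (fun a b => a ≫ (castIso (List.append_assoc _ _ _)).hom ≫ b) h₁ h₂).trans ?_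
    refine (congrArg _ (castIso_trans _ _)).trans ((castIso_trans _ _).trans ?_)
    exact (castIso_trans _ _).symm)
  (triangle := fun X Y => by
    have h₁ := castIso_tensor (T := T) (List.append_nil X.poly) (rfl : Y.poly = _)
    have h₂ := castIso_tensor (T := T) (rfl : X.poly = _) (List.nil_append Y.poly)
    refine (congrArg _ h₂).trans ((castIso_trans _ _).trans ?_)
    exact h₁.symm)

theorem symmM_hasType (U : Monom T.sig) : ∀ Q : Polyn T.sig,
    (Tape.symmM U Q).HasType (U :: Q) (Q ++ [U])
  | [] => .id U
  | V :: Q => .seq (.plus (P₁ := [U, V]) (Q₁ := [V, U]) (.symm U V) (idP_hasType Q))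
      (.plus (P₁ := [V]) (Q₁ := [V]) (.id V) (symmM_hasType U Q))

theorem symmP_hasType : ∀ P Q : Polyn T.sig, (Tape.symmP P Q).HasType (P ++ Q) (Q ++ P)
  | [], Q => by simpa [Tape.symmP] using idP_hasType Q
  | U :: P, Q => by
      have h := Tape.HasType.seq (.plus (P₁ := [U]) (Q₁ := [U]) (.id U) (symmP_hasType P Q))
        (.plus (P₁ := U :: Q) (symmM_hasType U Q) (idP_hasType P))
      simpa [Tape.symmP] using h

/-- The symmetry of the sum. -/
def swap (X Y : KCT T) : X ⊗ Y ⟶ Y ⊗ X := arrowOf (Tape.symmP X.poly Y.poly) (symmP_hasType _ _)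

theorem swap_swap (X Y : KCT T) : swap X Y ≫ swap Y X = 𝟙 _ :=
  sound _ _ (.symm_inv _ _)

theorem swap_natural_left {X Y : KCT T} (f : X ⟶ Y) (Z : KCT T) :
    f ▷ Z ≫ swap Y Z = swap X Z ≫ Z ◁ f := by
  obtain ⟨t, h, rfl⟩ := exists_arrowOf f
  exact sound _ _ (.symm_nat _ h)

theorem swap_natural_right {X Y : KCT T} (f : X ⟶ Y) (Z : KCT T) :
    Z ◁ f ≫ swap Z Y = swap Z X ≫ f ▷ Z := by
  have h := congrArg (fun g => swap Z X ≫ g ≫ swap Z Y) (swap_natural_left f Z)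
  simp only [Category.assoc, swap_swap, Category.comp_id] at h
  rw [h, ← Category.assoc (swap Z X), swap_swap, Category.id_comp]

/-- A monomial, as an object. -/
def mono (T : KCTheory.{u, v}) (U : Monom T.sig) : KCT T := ⟨[U]⟩

theorem castIso_inv {P Q : Polyn T.sig} (h : P = Q) :
    (castIso (T := T) h).inv = (castIso h.symm).hom := by
  subst h; rfl

theorem swap_nil_left (Y : KCT T) : swap (𝟙_ (KCT T)) Y = (λ_ Y).hom ≫ (ρ_ Y).inv := by
  refine .trans ?_ (congrArg (fun f => (λ_ Y).hom ≫ f) (castIso_inv (List.append_nil Y.poly))).symm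
  exact (comp_castIso_hom (List.append_nil Y.poly).symm (idP_hasType _)).symm

/-- Unfolding `symmP` at a singleton leaves an identity in front and a summand `idZero`; both are
absorbed by the unit laws. -/
theorem swap_mono (U : Monom T.sig) (Y : KCT T) :
    swap (mono T U) Y = ofTape (mono T U ⊗ Y) (Y ⊗ mono T U) (Tape.symmM U Y.poly)
      (symmM_hasType U Y.poly) := by
  have h : Tape.HasType (.plus (.id U) (Tape.idP Y.poly)) (U :: Y.poly) (U :: Y.poly) :=
    .plus (P₁ := [U]) (Q₁ := [U]) (.id U) (idP_hasType _)
  have h₂ : Tape.HasType (.plus (Tape.symmM U Y.poly) .idZero) (U :: Y.poly) (Y.poly ++ [U]) := by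
    simpa using Tape.HasType.plus (symmM_hasType U Y.poly) .idZero
  have h₁ : ofTape (mono T U ⊗ Y) (Y ⊗ mono T U) (.plus (Tape.symmM U Y.poly) .idZero) h₂ =
      ofTape _ _ (Tape.symmM U Y.poly) (symmM_hasType U Y.poly) :=
    sound _ _ (.plus_zero (symmM_hasType U Y.poly))
  exact (Category.id_comp (ofTape (mono T U ⊗ Y) (Y ⊗ mono T U) _ h₂)).trans h₁

theorem id_mono (U : Monom T.sig) : 𝟙 (mono T U) = ofTape (mono T U) (mono T U) (.id U) (.id U) :=
  sound _ _ (.plus_zero (.id U))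

/-- This is the recursive clause of `symmP` read as a hexagon whose first summand is a monomial; the
associators are identities. -/
theorem swap_mono_tensor (U : Monom T.sig) (X Y : KCT T) :
    swap (mono T U ⊗ X) Y = (α_ (mono T U) X Y).hom ≫ mono T U ◁ swap X Y ≫
      (α_ (mono T U) Y X).inv ≫ swap (mono T U) Y ▷ X ≫ (α_ Y (mono T U) X).hom := by
  have hs : (𝟙 (mono T U) ⊗ₘ swap X Y) = ofTape (mono T U ⊗ X ⊗ Y) (mono T U ⊗ Y ⊗ X)
      (.plus (.id U) (Tape.symmP X.poly Y.poly))
      (.plus (P₁ := [U]) (Q₁ := [U]) (.id U) (symmP_hasType _ _)) := by rw [id_mono]; rfl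
  rw [swap_mono, ← MonoidalCategory.id_tensorHom, hs]
  have ha : (ofTape (mono T U ⊗ Y) (Y ⊗ mono T U) _ (symmM_hasType U Y.poly) ▷ X ≫
      (α_ Y (mono T U) X).hom) = ofTape ((mono T U ⊗ Y) ⊗ X) (Y ⊗ mono T U ⊗ X)
        (.plus (Tape.symmM U Y.poly) (Tape.idP X.poly)) (by
          simpa [tensorObj, mono] using
            Tape.HasType.plus (symmM_hasType U Y.poly) (idP_hasType X.poly)) :=
    comp_castIso_hom (List.append_assoc _ _ _)
      (.plus (symmM_hasType U Y.poly) (idP_hasType X.poly))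
  rw [ha]
  refine .symm <| (Category.id_comp _).trans ?_
  exact congrArg (fun f => ofTape (mono T U ⊗ X ⊗ Y) (mono T U ⊗ Y ⊗ X) _ _ ≫ f)
    (Category.id_comp _)

/-- The symmetry is defined by recursion on its first argument, so the hexagon follows by induction
on the list underlying `X`. In the inductive step `swap_mono_tensor` splits off the leading monomial
on both sides, and the rest is coherence. -/
theorem swap_tensor_left (X Y Z : KCT T) :
    swap (X ⊗ Y) Z = (α_ X Y Z).hom ≫ X ◁ swap Y Z ≫ (α_ X Z Y).inv ≫ swap X Z ▷ Y ≫
      (α_ Z X Y).hom := by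
  obtain ⟨P⟩ := X
  induction P with
  | nil =>
    have h : swap ((𝟙_ (KCT T)) ⊗ Y) Z = (λ_ Y).hom ▷ Z ≫ swap Y Z ≫ Z ◁ (λ_ Y).inv := by
      rw [reassoc_of% swap_natural_left]; simp
    refine h.trans ?_
    change _ = (α_ (𝟙_ (KCT T)) Y Z).hom ≫ (𝟙_ (KCT T)) ◁ swap Y Z ≫ (α_ (𝟙_ (KCT T)) Z Y).inv ≫
      swap (𝟙_ (KCT T)) Z ▷ Y ≫ (α_ Z (𝟙_ (KCT T)) Y).hom
    rw [swap_nil_left]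
    monoidal
  | cons U P ih =>
    change swap ((mono T U ⊗ (⟨P⟩ : KCT T)) ⊗ Y) Z =
      (α_ (mono T U ⊗ (⟨P⟩ : KCT T)) Y Z).hom ≫ (mono T U ⊗ (⟨P⟩ : KCT T)) ◁ swap Y Z ≫
        (α_ (mono T U ⊗ (⟨P⟩ : KCT T)) Z Y).inv ≫ swap (mono T U ⊗ (⟨P⟩ : KCT T)) Z ▷ Y ≫
        (α_ Z (mono T U ⊗ (⟨P⟩ : KCT T)) Y).hom
    have h₄ : swap ((mono T U ⊗ (⟨P⟩ : KCT T)) ⊗ Y) Z =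
        (α_ (mono T U) ⟨P⟩ Y).hom ▷ Z ≫ swap (mono T U ⊗ (⟨P⟩ : KCT T) ⊗ Y) Z ≫
          Z ◁ (α_ (mono T U) ⟨P⟩ Y).inv := by
      rw [reassoc_of% swap_natural_left]; simp
    rw [h₄, swap_mono_tensor, ih, swap_mono_tensor]
    monoidal

/-- Each side is inverse to `swap (Y ⊗ Z) X`, as expanded by the other hexagon. -/
theorem swap_tensor_right (X Y Z : KCT T) :
    swap X (Y ⊗ Z) = (α_ X Y Z).inv ≫ swap X Y ▷ Z ≫ (α_ Y X Z).hom ≫ Y ◁ swap X Z ≫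
      (α_ Y Z X).inv := by
  have : IsIso (swap (Y ⊗ Z) X) := ⟨swap _ _, swap_swap _ _, swap_swap _ _⟩
  rw [← cancel_epi (swap (Y ⊗ Z) X), swap_swap, swap_tensor_left]
  have h₁ : swap Y X ▷ Z ≫ swap X Y ▷ Z = 𝟙 _ := by rw [← comp_whiskerRight, swap_swap]; simp
  have h₂ : Y ◁ swap Z X ≫ Y ◁ swap X Z = 𝟙 _ := by
    rw [← MonoidalCategory.whiskerLeft_comp, swap_swap]; simp
  simp only [Category.assoc, Iso.hom_inv_id_assoc, reassoc_of% h₁, Iso.inv_hom_id_assoc,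
    reassoc_of% h₂, Iso.hom_inv_id]

instance : BraidedCategory (KCT T) where
  braiding X Y := ⟨swap X Y, swap Y X, swap_swap X Y, swap_swap Y X⟩
  braiding_naturality_left := swap_natural_left
  braiding_naturality_right Z _ _ f := swap_natural_right f Z
  hexagon_forward X Y Z := by simp [swap_tensor_right]
  hexagon_reverse X Y Z := by simp [swap_tensor_left]

instance : SymmetricCategory (KCT T) where
  symmetry := swap_swap

end KCT

/-! ### Middle-four interchange in a symmetric monoidal category. -/

section Symmetric

open MonoidalCategory BraidedCategory

variable {C : Type u} [Category.{v} C] [MonoidalCategory C] [SymmetricCategory C]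

theorem tensorμ_tensorμ (X₁ X₂ Y₁ Y₂ : C) :
    tensorμ X₁ X₂ Y₁ Y₂ ≫ tensorμ X₁ Y₁ X₂ Y₂ = 𝟙 _ := by
  have h : tensorμ X₁ Y₁ X₂ Y₂ = tensorδ X₁ X₂ Y₁ Y₂ := by
    simp only [tensorμ, tensorδ, SymmetricCategory.braiding_swap_eq_inv_braiding X₂ Y₁]
  rw [h, tensorμ_tensorδ]

/-- The braiding of `X ⊗ X` past `Y ⊗ Y` consists of four crossings, one of which undoes the
crossing in `tensorμ`. Of the three that remain, two form the pair of braidings and one is the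
middle interchange. -/
theorem braiding_tensor_braiding_comp_tensorμ (X Y : C) :
    ((β_ X Y).hom ⊗ₘ (β_ X Y).hom) ≫ tensorμ Y X Y X =
      tensorμ X Y X Y ≫ (β_ (X ⊗ X) (Y ⊗ Y)).hom := by
  symm
  calc
    _ = 𝟙 _ ⊗≫ X ◁ ((β_ Y X).hom ≫ (β_ X Y).hom) ▷ Y ⊗≫ (β_ X Y).hom ▷ (X ⊗ Y) ⊗≫
        (Y ⊗ X) ◁ (β_ X Y).hom ⊗≫ Y ◁ (β_ X Y).hom ▷ X ⊗≫ 𝟙 _ := by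
      simp only [tensorμ, braiding_tensor_right_hom, braiding_tensor_left_hom]
      monoidal
    _ = _ := by
      rw [SymmetricCategory.symmetry, MonoidalCategory.tensorHom_def]
      simp only [tensorμ]
      monoidal

/-- The two crossings of `Y₁` and `Y₂` cancel. This and `tensorμ_associator` identify the rewiring
of inputs and outputs in `trace_tensor_trace`. -/
theorem braiding_whisker_tensorμ (X₁ X₂ Y₁ Y₂ : C) :
    X₁ ◁ (X₂ ◁ (β_ Y₁ Y₂).hom ≫ (α_ X₂ Y₂ Y₁).inv ≫ (β_ (X₂ ⊗ Y₂) Y₁).hom) ≫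
        (α_ X₁ Y₁ (X₂ ⊗ Y₂)).inv =
      (α_ X₁ X₂ (Y₁ ⊗ Y₂)).inv ≫ tensorμ X₁ X₂ Y₁ Y₂ := by
  have h : X₂ ◁ (β_ Y₁ Y₂).hom ≫ X₂ ◁ (β_ Y₂ Y₁).hom = 𝟙 _ := by
    rw [← MonoidalCategory.whiskerLeft_comp]; simp
  simp only [tensorμ, braiding_tensor_left_hom, Iso.inv_hom_id_assoc, reassoc_of% h,
    MonoidalCategory.whiskerLeft_comp, Category.assoc]

theorem tensorμ_associator (X₁ X₂ Y₁ Y₂ : C) :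
    tensorμ X₁ Y₁ X₂ Y₂ ≫ (α_ X₁ X₂ (Y₁ ⊗ Y₂)).hom =
      (α_ X₁ Y₁ (X₂ ⊗ Y₂)).hom ≫ X₁ ◁ ((β_ Y₁ (X₂ ⊗ Y₂)).hom ≫ (α_ X₂ Y₂ Y₁).hom ≫
        X₂ ◁ (β_ Y₂ Y₁).hom) := by
  have h : X₂ ◁ (β_ Y₁ Y₂).hom ≫ X₂ ◁ (β_ Y₂ Y₁).hom = 𝟙 _ := by
    rw [← MonoidalCategory.whiskerLeft_comp]; simp
  simp only [tensorμ, braiding_tensor_right_hom, Iso.inv_hom_id_assoc, h, Category.assoc,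
    Iso.inv_hom_id, Category.comp_id, MonoidalCategory.whiskerLeft_comp]

/-- The arrow `a ⊕ b` on a doubled sum, for arrows `a` and `b` on the doubled summands. -/
def doubleSum {X Y : C} (a : X ⊗ X ⟶ X ⊗ X) (b : Y ⊗ Y ⟶ Y ⊗ Y) :
    (X ⊗ Y) ⊗ (X ⊗ Y) ⟶ (X ⊗ Y) ⊗ (X ⊗ Y) :=
  tensorμ X Y X Y ≫ (a ⊗ₘ b) ≫ tensorμ X X Y Y

/-- Both sides apply `a`, `b`, `c` between regroupings of six factors, which agree by the coherence
of `tensorμ` with associators. With the unit and braiding lemmas below, this lets `doubleSum` extend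
`∇ ; Δ` along the sum. -/
theorem doubleSum_assoc {X Y Z : C} (a : X ⊗ X ⟶ X ⊗ X) (b : Y ⊗ Y ⟶ Y ⊗ Y)
    (c : Z ⊗ Z ⟶ Z ⊗ Z) :
    doubleSum (doubleSum a b) c ≫ ((α_ X Y Z).hom ⊗ₘ (α_ X Y Z).hom) =
      ((α_ X Y Z).hom ⊗ₘ (α_ X Y Z).hom) ≫ doubleSum a (doubleSum b c) := by
  have h₁ : (tensorμ X Y X Y ≫ (a ⊗ₘ b) ≫ tensorμ X X Y Y ⊗ₘ c) =
      tensorμ X Y X Y ▷ (Z ⊗ Z) ≫ ((a ⊗ₘ b) ⊗ₘ c) ≫ tensorμ X X Y Y ▷ (Z ⊗ Z) := by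
    simp only [← MonoidalCategory.tensorHom_id, tensorHom_comp_tensorHom, Category.id_comp,
      Category.comp_id]
  have h₂ : (a ⊗ₘ tensorμ Y Z Y Z ≫ (b ⊗ₘ c) ≫ tensorμ Y Y Z Z) =
      (X ⊗ X) ◁ tensorμ Y Z Y Z ≫ (a ⊗ₘ b ⊗ₘ c) ≫ (X ⊗ X) ◁ tensorμ Y Y Z Z := by
    simp only [← MonoidalCategory.id_tensorHom, tensorHom_comp_tensorHom, Category.id_comp,
      Category.comp_id]
  simp only [doubleSum, Category.assoc]
  rw [h₁, h₂]
  have h₃ := tensor_associativity X X Y Y Z Z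
  have h₄ := associator_monoidal X Y Z X Y Z
  simp only [Category.assoc] at h₃ h₄ ⊢
  rw [h₃, ← reassoc_of% h₄]
  simp

theorem braiding_comp_doubleSum {X Y : C} (a : X ⊗ X ⟶ X ⊗ X) (b : Y ⊗ Y ⟶ Y ⊗ Y) :
    ((β_ X Y).hom ⊗ₘ (β_ X Y).hom) ≫ doubleSum b a =
      doubleSum a b ≫ ((β_ X Y).hom ⊗ₘ (β_ X Y).hom) := by
  have h := braiding_tensor_braiding_comp_tensorμ X Y
  have h₁ : tensorμ X X Y Y ≫ ((β_ X Y).hom ⊗ₘ (β_ X Y).hom) =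
      (β_ (X ⊗ X) (Y ⊗ Y)).hom ≫ tensorμ Y Y X X := by
    have h₂ := congrArg (fun f => tensorμ X X Y Y ≫ f ≫ tensorμ Y Y X X) h
    simpa only [Category.assoc, tensorμ_tensorμ, Category.comp_id,
      reassoc_of% tensorμ_tensorμ] using h₂
  simp only [doubleSum, Category.assoc, h₁, reassoc_of% h, braiding_naturality_assoc]

theorem doubleSum_unit_left {X : C} (a : X ⊗ X ⟶ X ⊗ X) :
    doubleSum (𝟙 (𝟙_ C ⊗ 𝟙_ C)) a ≫ ((λ_ X).hom ⊗ₘ (λ_ X).hom) =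
      ((λ_ X).hom ⊗ₘ (λ_ X).hom) ≫ a := by
  have h : tensorμ (𝟙_ C) (𝟙_ C) X X ≫ ((λ_ X).hom ⊗ₘ (λ_ X).hom) =
      (λ_ (𝟙_ C)).hom ▷ (X ⊗ X) ≫ (λ_ (X ⊗ X)).hom := by
    rw [tensor_left_unitality X X, hom_inv_whiskerRight_assoc]
  simp only [doubleSum, Category.assoc, h, MonoidalCategory.id_tensorHom, whisker_exchange_assoc,
    leftUnitor_naturality]
  simp only [leftUnitor_monoidal, Category.assoc]

theorem doubleSum_unit_right {X : C} (a : X ⊗ X ⟶ X ⊗ X) :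
    doubleSum a (𝟙 (𝟙_ C ⊗ 𝟙_ C)) ≫ ((ρ_ X).hom ⊗ₘ (ρ_ X).hom) =
      ((ρ_ X).hom ⊗ₘ (ρ_ X).hom) ≫ a := by
  have h : tensorμ X X (𝟙_ C) (𝟙_ C) ≫ ((ρ_ X).hom ⊗ₘ (ρ_ X).hom) =
      (X ⊗ X) ◁ (λ_ (𝟙_ C)).hom ≫ (ρ_ (X ⊗ X)).hom := by
    rw [tensor_right_unitality X X, whiskerLeft_hom_inv_assoc]
  simp only [doubleSum, Category.assoc, h, MonoidalCategory.tensorHom_id, ← whisker_exchange_assoc,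
    rightUnitor_naturality]
  simp only [rightUnitor_monoidal, Category.assoc]

/-- By coassociativity the two middle copies can be produced by a single `d`, and cocommutativity
then absorbs their exchange. -/
theorem comul_tensor_comul_tensorμ {X : C} {d : X ⟶ X ⊗ X}
    (assoc : d ≫ X ◁ d = d ≫ d ▷ X ≫ (α_ X X X).hom) (comm : d ≫ (β_ X X).hom = d) :
    d ≫ (d ⊗ₘ d) ≫ tensorμ X X X X = d ≫ (d ⊗ₘ d) := by
  have h : d ≫ (d ⊗ₘ d) = d ≫ X ◁ (d ≫ d ▷ X ≫ (α_ X X X).hom) ≫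
      (α_ X X (X ⊗ X)).inv := by
    rw [← assoc, MonoidalCategory.tensorHom_def]
    have h₁ := congrArg (fun f => f ≫ (α_ X X X).inv) assoc
    simp only [Category.assoc, Iso.hom_inv_id, Category.comp_id] at h₁
    rw [← reassoc_of% h₁]
    simp
  have hc : d ▷ X ≫ (β_ X X).hom ▷ X = d ▷ X := by rw [← comp_whiskerRight, comm]
  rw [reassoc_of% h, h]
  simp only [tensorμ, Iso.inv_hom_id_assoc, ← MonoidalCategory.whiskerLeft_comp_assoc,
    Category.assoc, Iso.hom_inv_id_assoc, reassoc_of% hc]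

theorem tensorμ_mul_tensor_mul {X : C} {m : X ⊗ X ⟶ X}
    (assoc : X ◁ m ≫ m = (α_ X X X).inv ≫ m ▷ X ≫ m) (comm : (β_ X X).hom ≫ m = m) :
    tensorμ X X X X ≫ (m ⊗ₘ m) ≫ m = (m ⊗ₘ m) ≫ m := by
  have h : (m ⊗ₘ m) ≫ m = (α_ X X (X ⊗ X)).hom ≫ X ◁ ((α_ X X X).inv ≫ m ▷ X ≫ m) ≫ m := by
    rw [← assoc, MonoidalCategory.tensorHom_def', Category.assoc]
    have h₁ := congrArg (fun f => (α_ X X X).hom ≫ f) assoc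
    simp only [Iso.hom_inv_id_assoc] at h₁
    rw [← h₁]
    simp
  have hc : (β_ X X).hom ▷ X ≫ m ▷ X = m ▷ X := by rw [← comp_whiskerRight, comm]
  rw [h]
  simp only [tensorμ, Iso.inv_hom_id_assoc, ← MonoidalCategory.whiskerLeft_comp_assoc,
    Category.assoc, Iso.hom_inv_id_assoc, reassoc_of% hc]

end Symmetric

namespace KCT

open MonoidalCategory BraidedCategory

variable {T : KCTheory.{u, v}}

theorem comp_le_comp {X Y Z : KCT T} {f f' : X ⟶ Y} {g g' : Y ⟶ Z} (h : f ≤ f') (k : g ≤ g') :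
    f ≫ g ≤ f' ≫ g' := by
  obtain ⟨_, _, rfl⟩ := exists_arrowOf f
  obtain ⟨_, _, rfl⟩ := exists_arrowOf f'
  obtain ⟨_, _, rfl⟩ := exists_arrowOf g
  obtain ⟨_, _, rfl⟩ := exists_arrowOf g'
  exact Precong.seq (I := kcAxioms T.sig ∪ T.ax) h k

theorem tensor_le_tensor {X Y X' Y' : KCT T} {f f' : X ⟶ Y} {g g' : X' ⟶ Y'} (h : f ≤ f')
    (k : g ≤ g') : (f ⊗ₘ g) ≤ (f' ⊗ₘ g') := by
  obtain ⟨_, _, rfl⟩ := exists_arrowOf f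
  obtain ⟨_, _, rfl⟩ := exists_arrowOf f'
  obtain ⟨_, _, rfl⟩ := exists_arrowOf g
  obtain ⟨_, _, rfl⟩ := exists_arrowOf g'
  exact Precong.plus (I := kcAxioms T.sig ∪ T.ax) h k

/-! ### The generators of the sum -/

/-- The arrow of a circuit. -/
def circ {U V : Monom T.sig} (c : Circ T.sig) (h : c.HasType U V) : mono T U ⟶ mono T V :=
  ofTape _ _ (.emb c) (.emb h)

/-- The diagonal of a monomial. -/
def diag (U : Monom T.sig) : mono T U ⟶ mono T U ⊗ mono T U := ofTape _ _ (.diag U) (.diag U)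

/-- The codiagonal of a monomial. -/
def codiag (U : Monom T.sig) : mono T U ⊗ mono T U ⟶ mono T U :=
  ofTape (mono T U ⊗ mono T U) (mono T U) (.codiag U) (.codiag U)

/-- The unique arrow from a monomial to the zero object. -/
def bang (U : Monom T.sig) : mono T U ⟶ 𝟙_ (KCT T) := ofTape _ _ (.bang U) (.bang U)

/-- The unique arrow from the zero object to a monomial. -/
def cobang (U : Monom T.sig) : 𝟙_ (KCT T) ⟶ mono T U := ofTape _ _ (.cobang U) (.cobang U)

theorem braiding_mono (U V : Monom T.sig) :
    (β_ (mono T U) (mono T V)).hom =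
      ofTape (mono T U ⊗ mono T V) (mono T V ⊗ mono T U) (.symm U V) (.symm U V) := by
  have h : (β_ (mono T U) (mono T V)).hom = ofTape (mono T U ⊗ mono T V) (mono T V ⊗ mono T U)
      (.seq (.plus (.symm U V) .idZero) (.plus (.id V) (.id U)))
      (.seq (.plus (P₁ := [U, V]) (Q₁ := [V, U]) (.symm U V) .idZero)
        (.plus (P₁ := [V]) (Q₁ := [V]) (.id V) (.id U))) := swap_mono U (mono T V)
  have h₁ : ofTape (mono T U ⊗ mono T V) (mono T V ⊗ mono T U) (.plus (.symm U V) .idZero)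
      (.plus (P₁ := [U, V]) (Q₁ := [V, U]) (.symm U V) .idZero) =
      ofTape (mono T U ⊗ mono T V) (mono T V ⊗ mono T U) (.symm U V) (.symm U V) :=
    sound _ _ (.plus_zero (.symm U V))
  have h₂ : (ofTape (mono T V) (mono T V) (.id V) (.id V) ⊗ₘ
      ofTape (mono T U) (mono T U) (.id U) (.id U)) =
    𝟙 (mono T V ⊗ mono T U) := by rw [← id_mono, ← id_mono, id_tensorHom_id]
  rw [h, ← h₁]
  exact (congrArg (fun f => ofTape (mono T U ⊗ mono T V) (mono T V ⊗ mono T U)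
    (.plus (.symm U V) .idZero) (.plus (P₁ := [U, V]) (Q₁ := [V, U]) (.symm U V) .idZero) ≫ f)
    h₂).trans (Category.comp_id _)

theorem codiag_assoc (U : Monom T.sig) :
    mono T U ◁ codiag U ≫ codiag U = (α_ _ _ _).inv ≫ codiag U ▷ mono T U ≫ codiag U := by
  rw [← MonoidalCategory.id_tensorHom, ← MonoidalCategory.tensorHom_id, id_mono]
  exact (sound _ _ (.codiag_assoc U)).trans (castIso_hom_comp (P := [U, U, U]) (P' := [U, U, U])
    rfl (.seq (.plus (.codiag U) (.id U)) (.codiag U))).symm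

theorem codiag_comm (U : Monom T.sig) : (β_ (mono T U) (mono T U)).hom ≫ codiag U = codiag U := by
  rw [braiding_mono]
  exact sound _ _ (.codiag_comm U)

theorem diag_assoc (U : Monom T.sig) :
    diag U ≫ mono T U ◁ diag U = diag U ≫ diag U ▷ mono T U ≫ (α_ _ _ _).hom := by
  rw [← MonoidalCategory.id_tensorHom, ← MonoidalCategory.tensorHom_id, id_mono]
  exact (sound _ _ (.diag_assoc U)).trans
    (congrArg (fun f => diag U ≫ f) (comp_castIso_hom (Q := [U, U, U]) (Q' := [U, U, U]) rfl
      (.plus (.diag U) (.id U))).symm)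

theorem diag_comm (U : Monom T.sig) : diag U ≫ (β_ (mono T U) (mono T U)).hom = diag U := by
  rw [braiding_mono]
  exact sound _ _ (.diag_comm U)

theorem diag_bang (U : Monom T.sig) : diag U ≫ (bang U ⊗ₘ bang U) = bang U ≫ (λ_ _).inv := by
  have h : diag U ≫ bang U ▷ mono T U = 𝟙 (mono T U) ≫ (λ_ _).inv := by
    rw [← MonoidalCategory.tensorHom_id, id_mono]
    exact (sound _ _ (.diag_unit U)).trans
      (comp_castIso_hom (Q := [U]) (Q' := [U]) rfl (.id U)).symm
  rw [MonoidalCategory.tensorHom_def, reassoc_of% h]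
  simp

theorem cobang_codiag (U : Monom T.sig) :
    (cobang U ⊗ₘ cobang U) ≫ codiag U = (λ_ _).hom ≫ cobang U := by
  have h : cobang U ▷ mono T U ≫ codiag U = (λ_ _).hom := by
    rw [← MonoidalCategory.tensorHom_id, id_mono]
    exact (sound _ _ (.codiag_unit U)).trans (id_mono U).symm
  rw [MonoidalCategory.tensorHom_def', Category.assoc, h]
  simp

theorem codiag_bang (U : Monom T.sig) :
    codiag U ≫ bang U = (bang U ⊗ₘ bang U) ≫ (λ_ _).hom := by
  refine (sound (T := T) (P := [U, U]) (Q := []) _ (.plus (P₁ := [U]) (Q₁ := []) (.bang U)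
    (.plus (P₁ := [U]) (Q₁ := []) (.bang U) .idZero)) (.codiag_bang U)).trans ?_
  refine .trans ?_ (Category.comp_id (X := mono T U ⊗ mono T U) _).symm
  exact congrArg (fun f => bang U ⊗ₘ f)
    (sound (T := T) (P := [U]) (Q := []) (.plus (P₁ := [U]) (Q₁ := []) (.bang U) .idZero)
      (.bang U) (.plus_zero (.bang U)))

theorem cobang_diag (U : Monom T.sig) :
    cobang U ≫ diag U = (λ_ _).inv ≫ (cobang U ⊗ₘ cobang U) := by
  refine (sound (T := T) (P := []) (Q := [U, U]) _ (.plus (P₁ := []) (Q₁ := [U]) (.cobang U)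
    (.plus (P₁ := []) (Q₁ := [U]) (.cobang U) .idZero)) (.cobang_diag U)).trans ?_
  refine .trans ?_ (Category.id_comp (Y := mono T U ⊗ mono T U) _).symm
  exact congrArg (fun f => cobang U ⊗ₘ f)
    (sound (T := T) (P := []) (Q := [U]) (.plus (P₁ := []) (Q₁ := [U]) (.cobang U) .idZero)
      (.cobang U) (.plus_zero (.cobang U)))

/-- The axiom `TapeEq.bi` is phrased with `diagP [U, U]`. Its unfolding is matched with `tensorμ`:
`h₁` removes the padding of `diagP [U]`, and `h₂` uses that all associators around the middle
symmetry are identities on `[U, U, U, U]`. -/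
theorem codiag_diag (U : Monom T.sig) :
    codiag U ≫ diag U = (diag U ⊗ₘ diag U) ≫ tensorμ _ _ _ _ ≫ (codiag U ⊗ₘ codiag U) := by
  have hd : Tape.HasType (Tape.diagP [U]) [U] [U, U] := .seq
    (.plus (P₁ := [U]) (Q₁ := [U, U]) (.diag U) .idZero)
    (.plus (P₁ := [U, U]) (Q₁ := [U, U]) (.plus (P₁ := [U]) (Q₁ := [U]) (.id U)
      (symmP_hasType [U] [])) .idZero)
  have hm : Tape.HasType (.plus (.plus (.id U) (Tape.symmP [U] [U])) (Tape.idP [U]))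
      [U, U, U, U] [U, U, U, U] := .plus (P₁ := [U, U, U]) (Q₁ := [U, U, U])
    (.plus (P₁ := [U]) (Q₁ := [U]) (.id U) (symmP_hasType [U] [U])) (idP_hasType [U])
  have hU := id_mono (T := T) U
  have h₁ : ofTape (mono T U) (mono T U ⊗ mono T U) (Tape.diagP [U]) hd = diag U := by
    have h₃ : Equal T [U, U] [U, U] (.plus (.id U) (Tape.symmP [U] [])) (Tape.idP [U, U]) :=
      .plus (P := [U]) (Q := [U]) (.refl (.id U)) (.of_tapeEq (.id_seq (idP_hasType [U]))
        (symmP_hasType [U] []) (idP_hasType [U]))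
    have h₄ : Tape.HasType (.plus (.id U) (Tape.symmP [U] [])) [U, U] [U, U] :=
      .plus (P₁ := [U]) (Q₁ := [U]) (.id U) (symmP_hasType [U] [])
    exact arrowOf_eq (.trans (.seq (.of_tapeEq (.plus_zero (.diag U))
      (.plus (P₁ := [U]) (Q₁ := [U, U]) (.diag U) .idZero) (.diag U))
      (.trans (.of_tapeEq (.plus_zero h₄) (.plus (P₁ := [U, U]) (Q₁ := [U, U]) h₄ .idZero) h₄) h₃))
      (.of_tapeEq (.seq_id (.diag U)) (.seq (.diag U) (idP_hasType _)) (.diag U)))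
  have h₂ : ofTape ((mono T U ⊗ mono T U) ⊗ (mono T U ⊗ mono T U))
      ((mono T U ⊗ mono T U) ⊗ (mono T U ⊗ mono T U)) _ hm = tensorμ _ _ _ _ := by
    have hA : (α_ (mono T U) (mono T U) (mono T U ⊗ mono T U)).hom ≫
        mono T U ◁ (α_ (mono T U) (mono T U) (mono T U)).inv ≫
        (α_ (mono T U) (mono T U ⊗ mono T U) (mono T U)).inv = (castIso rfl).hom := by
      refine (congrArg (fun f => (α_ (mono T U) (mono T U) (mono T U ⊗ mono T U)).hom ≫ f ≫
        (α_ (mono T U) (mono T U ⊗ mono T U) (mono T U)).inv)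
        (castIso_tensor (T := T) (P := [U]) (P' := [U, U, U]) rfl rfl)).trans ?_
      exact (congrArg _ (castIso_trans (P := [U, U, U, U]) rfl rfl)).trans
        (castIso_trans (P := [U, U, U, U]) rfl rfl)
    have hB : (α_ (mono T U) (mono T U ⊗ mono T U) (mono T U)).hom ≫
        mono T U ◁ (α_ (mono T U) (mono T U) (mono T U)).hom ≫
        (α_ (mono T U) (mono T U) (mono T U ⊗ mono T U)).inv = (castIso rfl).hom := by
      refine (congrArg (fun f => (α_ (mono T U) (mono T U ⊗ mono T U) (mono T U)).hom ≫ f ≫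
        (α_ (mono T U) (mono T U) (mono T U ⊗ mono T U)).inv)
        (castIso_tensor (T := T) (P := [U]) (P' := [U, U, U]) rfl rfl)).trans ?_
      exact (congrArg _ (castIso_trans (P := [U, U, U, U]) rfl rfl)).trans
        (castIso_trans (P := [U, U, U, U]) rfl rfl)
    have hC : tensorμ (mono T U) (mono T U) (mono T U) (mono T U) =
        ((α_ (mono T U) (mono T U) (mono T U ⊗ mono T U)).hom ≫
          mono T U ◁ (α_ (mono T U) (mono T U) (mono T U)).inv ≫
          (α_ (mono T U) (mono T U ⊗ mono T U) (mono T U)).inv) ≫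
        (mono T U ◁ (β_ (mono T U) (mono T U)).hom) ▷ mono T U ≫
        (α_ (mono T U) (mono T U ⊗ mono T U) (mono T U)).hom ≫
        mono T U ◁ (α_ (mono T U) (mono T U) (mono T U)).hom ≫
        (α_ (mono T U) (mono T U) (mono T U ⊗ mono T U)).inv := by
      simp only [tensorμ]
      monoidal
    rw [hC, hA, hB, ← MonoidalCategory.id_tensorHom, hU]
    exact (castIso_hom_comp (P := [U, U, U, U]) rfl hm).symm.trans (congrArg _
      (comp_castIso_hom (Q := [U, U, U, U]) rfl hm).symm)
  rw [← h₂]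
  refine (sound (T := T) (P := [U, U]) (Q := [U, U]) _
    (.seq (.seq (.plus (P₁ := [U]) (Q₁ := [U, U]) (.diag U) hd) hm)
      (.plus (P₁ := [U, U]) (Q₁ := [U]) (.codiag U) (.codiag U))) (.bi U)).trans ?_
  refine .trans ?_ (Category.assoc (diag U ⊗ₘ diag U) (ofTape ((mono T U ⊗ mono T U) ⊗
    (mono T U ⊗ mono T U)) ((mono T U ⊗ mono T U) ⊗ (mono T U ⊗ mono T U)) _ hm)
      (codiag U ⊗ₘ codiag U))
  exact congrArg (fun f => ((diag U ⊗ₘ f) ≫ ofTape ((mono T U ⊗ mono T U) ⊗ (mono T U ⊗ mono T U))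
      ((mono T U ⊗ mono T U) ⊗ (mono T U ⊗ mono T U)) _ hm) ≫ (codiag U ⊗ₘ codiag U)) h₁

theorem circ_diag {U V : Monom T.sig} {c : Circ T.sig} (h : c.HasType U V) :
    circ c h ≫ diag V = diag U ≫ (circ c h ⊗ₘ circ c h) :=
  sound _ _ (.diag_nat h)

theorem codiag_circ {U V : Monom T.sig} {c : Circ T.sig} (h : c.HasType U V) :
    codiag U ≫ circ c h = (circ c h ⊗ₘ circ c h) ≫ codiag V :=
  sound (P := [U, U]) (Q := [V]) _ _ (.codiag_nat h)

/-! ### The trace -/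

/-- Monotonicity of the trace is uniformity along the identity; it is what makes `trace` well
defined on arrows. -/
theorem trace_mono {U : Monom T.sig} {P Q : Polyn T.sig} {t s : Tape T.sig}
    (ht : t.HasType (U :: P) (U :: Q)) (hs : s.HasType (U :: P) (U :: Q))
    (h : T.Le (U :: P) (U :: Q) t s) : T.Le P Q (t.tr U) (s.tr U) := by
  refine Precong.unif_right (S₁ := [U]) (S₂ := [U]) ht hs (.refl (idP_hasType [U])) ?_
  refine .trans (.seq h (Equal.id_plus_id [U] Q).1)
    (.trans ?_ (.seq (Equal.id_plus_id [U] P).2 (.refl hs)))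
  exact .trans (.ax (.inl (.inl (.seq_id hs))) (.seq hs (idP_hasType _)) hs)
    (.ax (.inl (.inr (.inl (.id_seq hs)))) hs (.seq (idP_hasType _) hs))

/-- The trace along a monomial. -/
def trace (U : Monom T.sig) {X Y : KCT T} : (mono T U ⊗ X ⟶ mono T U ⊗ Y) → (X ⟶ Y) :=
  Quotient.map (fun t => ⟨t.1.tr U, .tr t.2⟩)
    fun t s h => ⟨trace_mono t.2 s.2 h.1, trace_mono s.2 t.2 h.2⟩

theorem trace_tightening {U : Monom T.sig} {X' X Y Y' : KCT T} (r : X' ⟶ X)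
    (t : mono T U ⊗ X ⟶ mono T U ⊗ Y) (w : Y ⟶ Y') :
    trace U (mono T U ◁ r ≫ t ≫ mono T U ◁ w) = r ≫ trace U t ≫ w := by
  obtain ⟨_, hr, rfl⟩ := exists_arrowOf r
  obtain ⟨_, ht, rfl⟩ := exists_arrowOf t
  obtain ⟨_, hw, rfl⟩ := exists_arrowOf w
  rw [← MonoidalCategory.id_tensorHom, ← MonoidalCategory.id_tensorHom, id_mono, ← Category.assoc,
    ← Category.assoc]
  exact sound _ _ (.tightening hr ht hw)

theorem trace_strength {U : Monom T.sig} {X Y X' Y' : KCT T}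
    (t : mono T U ⊗ X ⟶ mono T U ⊗ Y) (s : X' ⟶ Y') :
    trace U ((α_ _ _ _).inv ≫ (t ⊗ₘ s) ≫ (α_ _ _ _).hom) = (trace U t ⊗ₘ s) := by
  obtain ⟨_, ht, rfl⟩ := exists_arrowOf t
  obtain ⟨_, hs, rfl⟩ := exists_arrowOf s
  refine (congrArg (trace (T := T) (X := X ⊗ X') (Y := Y ⊗ Y') U)
    ((Category.id_comp _).trans (Category.comp_id _))).trans ?_
  exact sound _ _ (.strength ht hs)

theorem trace_codiag_diag (U : Monom T.sig) : trace U (codiag U ≫ diag U) = 𝟙 (mono T U) :=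
  (sound (P := [U]) (Q := [U]) _ _ (.tr_codiag_diag U)).trans (id_mono U).symm

theorem trace_le_trace {U V : Monom T.sig} {X Y : KCT T} {t : mono T U ⊗ X ⟶ mono T U ⊗ Y}
    {r : mono T V ⊗ X ⟶ mono T V ⊗ Y} {s : mono T V ⟶ mono T U} (h : s ▷ X ≫ t ≤ r ≫ s ▷ Y) :
    trace U t ≤ trace V r := by
  obtain ⟨_, ht, rfl⟩ := exists_arrowOf t
  obtain ⟨_, hr, rfl⟩ := exists_arrowOf r
  obtain ⟨_, hs, rfl⟩ := exists_arrowOf s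
  exact Precong.unif_left (S₁ := [U]) (S₂ := [V]) ht hr (.refl hs) h

/-- The trace along the double of a monomial. -/
def trace₂ (U : Monom T.sig) {X Y : KCT T}
    (t : (mono T U ⊗ mono T U) ⊗ X ⟶ (mono T U ⊗ mono T U) ⊗ Y) : X ⟶ Y :=
  trace U (trace U ((α_ _ _ _).inv ≫ t ≫ (α_ _ _ _).hom))

theorem trace₂_le_trace₂ {U : Monom T.sig} {X Y : KCT T}
    {t r : (mono T U ⊗ mono T U) ⊗ X ⟶ (mono T U ⊗ mono T U) ⊗ Y}
    {s : mono T U ⊗ mono T U ⟶ mono T U ⊗ mono T U} (h : t ≫ s ▷ Y ≤ s ▷ X ≫ r) :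
    trace₂ U t ≤ trace₂ U r := by
  obtain ⟨a, ht, rfl⟩ := exists_arrowOf t
  obtain ⟨b, hr, rfl⟩ := exists_arrowOf r
  obtain ⟨c, hs, rfl⟩ := exists_arrowOf s
  have key (t : Tape T.sig) (ht : t.HasType (U :: U :: X.poly) (U :: U :: Y.poly)) :
      trace₂ U (ofTape ((mono T U ⊗ mono T U) ⊗ X) ((mono T U ⊗ mono T U) ⊗ Y) t ht) =
        ofTape _ _ (Tape.trP [U, U] t) (.tr (.tr ht)) :=
    congrArg (fun f => trace U (trace U f)) ((Category.id_comp _).trans (Category.comp_id _))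
  refine (key a ht).le.trans (le_trans ?_ (key b hr).ge)
  exact Precong.unif_right (S₁ := [U, U]) (S₂ := [U, U]) ht hr (.refl hs) h

theorem trace₂_tightening {U : Monom T.sig} {X' X Y Y' : KCT T} (r : X' ⟶ X)
    (t : (mono T U ⊗ mono T U) ⊗ X ⟶ (mono T U ⊗ mono T U) ⊗ Y) (w : Y ⟶ Y') :
    trace₂ U ((mono T U ⊗ mono T U) ◁ r ≫ t ≫ (mono T U ⊗ mono T U) ◁ w) =
      r ≫ trace₂ U t ≫ w := by
  rw [trace₂, trace₂, ← trace_tightening, ← trace_tightening]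
  simp

/-- Strength extracts a trace from the left summand only, so it is applied twice, with the summands
exchanged in between. Tightening then moves the symmetries inside the traces, where they assemble
into the two interchanges. -/
theorem trace_tensor_trace {U : Monom T.sig} {X Y X' Y' : KCT T}
    (t : mono T U ⊗ X ⟶ mono T U ⊗ Y) (s : mono T U ⊗ X' ⟶ mono T U ⊗ Y') :
    (trace U t ⊗ₘ trace U s) =
      trace₂ U (tensorμ _ _ _ _ ≫ (t ⊗ₘ s) ≫ tensorμ _ _ _ _) := by
  have h₁ : (trace U t ⊗ₘ trace U s) =
      (β_ _ _).hom ≫ (trace U s ⊗ₘ trace U t) ≫ (β_ _ _).hom := by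
    rw [braiding_naturality, SymmetricCategory.symmetry_assoc]
  have h₂ : (s ⊗ₘ trace U t) = (β_ _ _).hom ≫ (trace U t ⊗ₘ s) ≫ (β_ _ _).hom := by
    rw [braiding_naturality, SymmetricCategory.symmetry_assoc]
  have h₃ := braiding_whisker_tensorμ (mono T U) (mono T U) X X'
  have h₄ := tensorμ_associator (mono T U) (mono T U) Y Y'
  rw [h₁, ← trace_strength, h₂, ← trace_strength, ← trace_tightening, trace₂]
  congr 1
  simp only [Category.assoc]
  rw [h₄, ← reassoc_of% h₃]
  have h₅ := trace_tightening (mono T U ◁ (β_ X X').hom ≫ (α_ (mono T U) X' X).inv ≫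
    (β_ (mono T U ⊗ X') X).hom) ((α_ (mono T U) X (mono T U ⊗ X')).inv ≫ (t ⊗ₘ s) ≫
    (α_ (mono T U) Y (mono T U ⊗ Y')).hom) ((β_ Y (mono T U ⊗ Y')).hom ≫
    (α_ (mono T U) Y' Y).hom ≫ mono T U ◁ (β_ Y' Y).hom)
  simp only [Category.assoc] at h₅ ⊢
  exact h₅.symm

/-! ### Lax naturality of the codiagonal followed by the diagonal -/

/-- The codiagonal followed by the diagonal, on a polynomial. -/
def mix : ∀ P : Polyn T.sig, (⟨P⟩ : KCT T) ⊗ ⟨P⟩ ⟶ (⟨P⟩ : KCT T) ⊗ ⟨P⟩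
  | [] => 𝟙 _
  | U :: P => doubleSum (X := mono T U) (Y := ⟨P⟩) (codiag U ≫ diag U) (mix P)

/-- `mix` splits off one monomial at a time; associativity of `doubleSum` lets it split at any
point, as the inductive cases for sums and symmetries require. -/
theorem mix_append (P Q : Polyn T.sig) :
    mix (P ++ Q) = doubleSum (X := (⟨P⟩ : KCT T)) (Y := ⟨Q⟩) (mix P) (mix Q) := by
  induction P with
  | nil =>
    have h := doubleSum_unit_left (mix (T := T) Q)
    have h₁ : ((λ_ (⟨Q⟩ : KCT T)).hom ⊗ₘ (λ_ (⟨Q⟩ : KCT T)).hom) = (castIso rfl).hom :=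
      castIso_tensor (T := T) (P := Q) (P' := Q) rfl rfl
    rw [h₁] at h
    exact ((Category.comp_id _).symm.trans (h.trans (Category.id_comp _))).symm
  | cons U P ih =>
    have h := doubleSum_assoc (X := mono T U) (codiag U ≫ diag U) (mix (T := T) P) (mix (T := T) Q)
    have h₁ : ((α_ (mono T U) (⟨P⟩ : KCT T) ⟨Q⟩).hom ⊗ₘ (α_ (mono T U) (⟨P⟩ : KCT T) ⟨Q⟩).hom) =
      (castIso rfl).hom :=
      castIso_tensor (T := T) (P := U :: (P ++ Q)) (P' := U :: (P ++ Q)) rfl rfl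
    rw [h₁, ← ih] at h
    exact ((Category.comp_id _).symm.trans (h.trans (Category.id_comp _))).symm

theorem mix_mono (U : Monom T.sig) : mix [U] = codiag (T := T) U ≫ diag U := by
  have h := doubleSum_unit_right (X := mono T U) (codiag U ≫ diag U)
  have h₁ : ((ρ_ (mono T U)).hom ⊗ₘ (ρ_ (mono T U)).hom) = (castIso rfl).hom :=
    castIso_tensor (T := T) (P := [U]) (P' := [U]) rfl rfl
  rw [h₁] at h
  exact (Category.comp_id _).symm.trans (h.trans (Category.id_comp _))

/-- With `g = tensorμ ; (f ⊕ f) ; tensorμ`, conjugating the hypothesis by the involutive interchange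
gives `g ; (m ⊕ b) ≤ (m ⊕ a) ; g`. This is the premise of uniformity along `m` for `g ; (id ⊕ b)`
and `(id ⊕ a) ; g`, and by tightening their traces are the two sides. -/
theorem trace_tensor_self_comp_le {U : Monom T.sig} {X Y : KCT T}
    {f : mono T U ⊗ X ⟶ mono T U ⊗ Y} {m : mono T U ⊗ mono T U ⟶ mono T U ⊗ mono T U}
    {a : X ⊗ X ⟶ X ⊗ X} {b : Y ⊗ Y ⟶ Y ⊗ Y}
    (h : (f ⊗ₘ f) ≫ doubleSum m b ≤ doubleSum m a ≫ (f ⊗ₘ f)) :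
    (trace U f ⊗ₘ trace U f) ≫ b ≤ a ≫ (trace U f ⊗ₘ trace U f) := by
  have h₁ := comp_le_comp (le_refl (tensorμ _ _ _ _)) (comp_le_comp h (le_refl (tensorμ _ _ _ _)))
  simp only [doubleSum, Category.assoc, tensorμ_tensorμ, reassoc_of% tensorμ_tensorμ,
    Category.comp_id] at h₁
  rw [trace_tensor_trace]
  have hb := trace₂_tightening (𝟙 _) (tensorμ _ _ _ _ ≫ (f ⊗ₘ f) ≫ tensorμ _ _ _ _) b
  have ha := trace₂_tightening a (tensorμ _ _ _ _ ≫ (f ⊗ₘ f) ≫ tensorμ _ _ _ _) (𝟙 _)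
  simp only [MonoidalCategory.whiskerLeft_id, Category.id_comp, Category.comp_id] at ha hb
  rw [← ha, ← hb]
  refine trace₂_le_trace₂ (s := m) ?_
  rw [MonoidalCategory.tensorHom_def' m b, MonoidalCategory.tensorHom_def m a] at h₁
  simpa only [Category.assoc] using h₁

/-- Induction on the typing derivation. The generators satisfy an equality, composition and sum
preserve the inequality, and the trace is where uniformity enters. -/
theorem tensor_self_comp_mix_le {P Q : Polyn T.sig} {t : Tape T.sig} (h : t.HasType P Q) :
    (ofTape ⟨P⟩ ⟨Q⟩ t h ⊗ₘ ofTape ⟨P⟩ ⟨Q⟩ t h) ≫ mix Q ≤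
      mix P ≫ (ofTape ⟨P⟩ ⟨Q⟩ t h ⊗ₘ ofTape ⟨P⟩ ⟨Q⟩ t h) := by
  induction h with
  | id U =>
    change (ofTape (mono T U) (mono T U) (.id U) (.id U) ⊗ₘ
      ofTape (mono T U) (mono T U) (.id U) (.id U)) ≫ mix [U] ≤ mix [U] ≫
      (ofTape (mono T U) (mono T U) (.id U) (.id U) ⊗ₘ
      ofTape (mono T U) (mono T U) (.id U) (.id U))
    have h : (ofTape (mono T U) (mono T U) (.id U) (.id U) ⊗ₘ
        ofTape (mono T U) (mono T U) (.id U) (.id U)) = 𝟙 (mono T U ⊗ mono T U) := by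
      rw [← id_mono, id_tensorHom_id]
    exact ((congrArg (· ≫ mix [U]) h).trans ((Category.id_comp (mix [U])).trans
      ((Category.comp_id (mix [U])).symm.trans (congrArg (mix [U] ≫ ·) h.symm)))).le
  | idZero =>
    change (𝟙 (𝟙_ (KCT T)) ⊗ₘ 𝟙 (𝟙_ (KCT T))) ≫ mix [] ≤ mix [] ≫ (𝟙 (𝟙_ (KCT T)) ⊗ₘ 𝟙 (𝟙_ (KCT T)))
    rw [id_tensorHom_id]
    exact ((Category.id_comp (mix (T := T) [])).trans (Category.comp_id (mix (T := T) [])).symm).le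
  -- The naturality axioms cover every circuit, so no induction on circuits is needed.
  | @emb c U V h =>
    rw [mix_mono, mix_mono]
    change (circ c h ⊗ₘ circ c h) ≫ codiag V ≫ diag V ≤
      (codiag U ≫ diag U) ≫ (circ c h ⊗ₘ circ c h)
    rw [Category.assoc, ← circ_diag, ← Category.assoc, ← codiag_circ, Category.assoc]
  | symm U V =>
    change (ofTape (mono T U ⊗ mono T V) (mono T V ⊗ mono T U) (.symm U V) (.symm U V) ⊗ₘ
      ofTape (mono T U ⊗ mono T V) (mono T V ⊗ mono T U) (.symm U V) (.symm U V)) ≫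
      mix ([V] ++ [U]) ≤ mix ([U] ++ [V]) ≫
      (ofTape (mono T U ⊗ mono T V) (mono T V ⊗ mono T U) (.symm U V) (.symm U V) ⊗ₘ
      ofTape (mono T U ⊗ mono T V) (mono T V ⊗ mono T U) (.symm U V) (.symm U V))
    rw [← braiding_mono, mix_append, mix_append]
    exact (braiding_comp_doubleSum (X := mono T U) (Y := mono T V) (mix [U]) (mix [V])).le
  | @seq t s P Q R ht hs iht ihs =>
    have h : (ofTape ⟨P⟩ ⟨R⟩ (t.seq s) (.seq ht hs) ⊗ₘ ofTape ⟨P⟩ ⟨R⟩ (t.seq s) (.seq ht hs)) =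
      (ofTape ⟨P⟩ ⟨Q⟩ t ht ⊗ₘ ofTape ⟨P⟩ ⟨Q⟩ t ht) ≫ (ofTape ⟨Q⟩ ⟨R⟩ s hs ⊗ₘ ofTape ⟨Q⟩ ⟨R⟩ s hs) :=
      (tensorHom_comp_tensorHom (ofTape (⟨P⟩ : KCT T) ⟨Q⟩ t ht) (ofTape (⟨P⟩ : KCT T) ⟨Q⟩ t ht)
        (ofTape (⟨Q⟩ : KCT T) ⟨R⟩ s hs) (ofTape (⟨Q⟩ : KCT T) ⟨R⟩ s hs)).symm
    rw [h, Category.assoc, ← Category.assoc (mix P)]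
    refine (comp_le_comp le_rfl ihs).trans ?_
    rw [← Category.assoc]
    exact comp_le_comp iht le_rfl
  | @plus t s P Q P' Q' ht hs iht ihs =>
    rw [mix_append, mix_append]
    change ((ofTape ⟨P⟩ ⟨Q⟩ t ht ⊗ₘ ofTape ⟨P'⟩ ⟨Q'⟩ s hs) ⊗ₘ
      (ofTape ⟨P⟩ ⟨Q⟩ t ht ⊗ₘ ofTape ⟨P'⟩ ⟨Q'⟩ s hs)) ≫ _ ≤ _ ≫
      ((ofTape ⟨P⟩ ⟨Q⟩ t ht ⊗ₘ ofTape ⟨P'⟩ ⟨Q'⟩ s hs) ⊗ₘ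
      (ofTape ⟨P⟩ ⟨Q⟩ t ht ⊗ₘ ofTape ⟨P'⟩ ⟨Q'⟩ s hs))
    rw [doubleSum, doubleSum, tensorμ_natural_assoc, Category.assoc, Category.assoc,
      ← tensorμ_natural, tensorHom_comp_tensorHom_assoc, tensorHom_comp_tensorHom_assoc]
    exact comp_le_comp le_rfl (comp_le_comp (tensor_le_tensor iht ihs) le_rfl)
  | bang U =>
    rw [mix_mono]
    change (bang U ⊗ₘ bang U) ≫ 𝟙 _ ≤ (codiag U ≫ diag U) ≫ (bang U ⊗ₘ bang U)
    rw [Category.assoc, diag_bang, reassoc_of% codiag_bang]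
    simp
  -- By the bimonoid law the two sides differ only by an interchange of the four copies produced by
  -- `Δ`, which coassociativity and cocommutativity absorb. The case of `codiag` is dual.
  | diag U =>
    rw [mix_mono]
    change (diag U ⊗ₘ diag U) ≫ mix ([U] ++ [U]) ≤ (codiag U ≫ diag U) ≫ (diag U ⊗ₘ diag U)
    rw [mix_append, mix_mono]
    change (diag U ⊗ₘ diag U) ≫ doubleSum (X := mono T U) (Y := mono T U) (codiag U ≫ diag U)
      (codiag U ≫ diag U) ≤ _
    rw [doubleSum, ← tensorHom_comp_tensorHom, Category.assoc, ← reassoc_of% codiag_diag U,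
      comul_tensor_comul_tensorμ (diag_assoc U) (diag_comm U), Category.assoc]
  | cobang U =>
    rw [mix_mono]
    change (cobang U ⊗ₘ cobang U) ≫ codiag U ≫ diag U ≤ 𝟙 _ ≫ (cobang U ⊗ₘ cobang U)
    rw [reassoc_of% cobang_codiag, cobang_diag]
    simp
  | codiag U =>
    rw [mix_mono]
    change (codiag U ⊗ₘ codiag U) ≫ codiag U ≫ diag U ≤ mix ([U] ++ [U]) ≫ (codiag U ⊗ₘ codiag U)
    rw [mix_append, mix_mono]
    change (codiag U ⊗ₘ codiag U) ≫ codiag U ≫ diag U ≤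
      doubleSum (X := mono T U) (Y := mono T U) (codiag U ≫ diag U) (codiag U ≫ diag U) ≫
        (codiag U ⊗ₘ codiag U)
    rw [doubleSum, ← tensorHom_comp_tensorHom, Category.assoc, Category.assoc, Category.assoc,
      ← codiag_diag U, reassoc_of% tensorμ_mul_tensor_mul (codiag_assoc U) (codiag_comm U)]
  | @tr U t P Q ht ih =>
    -- By definition `mix (U :: P)` is a `doubleSum` with first component `∇ ; Δ` on `U`, the arrow
    -- along which uniformity is applied.
    change (ofTape (mono T U ⊗ ⟨P⟩) (mono T U ⊗ ⟨Q⟩) t ht ⊗ₘ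
      ofTape (mono T U ⊗ ⟨P⟩) (mono T U ⊗ ⟨Q⟩) t ht) ≫ doubleSum (codiag U ≫ diag U) (mix Q) ≤
      doubleSum (codiag U ≫ diag U) (mix P) ≫ (ofTape (mono T U ⊗ ⟨P⟩) (mono T U ⊗ ⟨Q⟩) t ht ⊗ₘ
      ofTape (mono T U ⊗ ⟨P⟩) (mono T U ⊗ ⟨Q⟩) t ht) at ih
    change (trace U (ofTape (mono T U ⊗ ⟨P⟩) (mono T U ⊗ ⟨Q⟩) t ht) ⊗ₘ
      trace U (ofTape (mono T U ⊗ ⟨P⟩) (mono T U ⊗ ⟨Q⟩) t ht)) ≫ mix Q ≤ mix P ≫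
      (trace U (ofTape (mono T U ⊗ ⟨P⟩) (mono T U ⊗ ⟨Q⟩) t ht) ⊗ₘ
      trace U (ofTape (mono T U ⊗ ⟨P⟩) (mono T U ⊗ ⟨Q⟩) t ht))
    exact trace_tensor_self_comp_le ih

/-! ### The Kleene star and its induction rule. -/

/-- The Kleene star of an arrow on a monomial. -/
def star {U : Monom T.sig} (f : mono T U ⟶ mono T U) : mono T U ⟶ mono T U :=
  trace U (f ▷ mono T U ≫ codiag U ≫ diag U)

theorem star_ofTape {U : Monom T.sig} {t : Tape T.sig} (ht : t.HasType [U] [U]) :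
    star (ofTape (mono T U) (mono T U) t ht) = ofTape (mono T U) (mono T U) (t.star U)
      (.tr (.seq (.seq (.plus ht (.id U)) (.codiag U)) (.diag U))) := by
  rw [star, ← MonoidalCategory.tensorHom_id, id_mono, ← Category.assoc]
  rfl

/-- Both sides are written as traces and compared by uniformity along `p`. Lax naturality of `∇ ; Δ`
supplies the premise. -/
theorem comp_star_le {U V : Monom T.sig} {p : mono T V ⟶ mono T U} {f : mono T U ⟶ mono T U}
    (h : p ≫ f ≤ p) : p ≫ star f ≤ p := by
  have hp : (p ⊗ₘ p) ≫ codiag U ≫ diag U ≤ (codiag V ≫ diag V) ≫ (p ⊗ₘ p) := by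
    obtain ⟨t, ht, rfl⟩ := exists_arrowOf p
    have h₁ := tensor_self_comp_mix_le (T := T) (P := [V]) (Q := [U]) ht
    rwa [mix_mono, mix_mono] at h₁
  have h₁ := trace_tightening p (f ▷ mono T U ≫ codiag U ≫ diag U) (𝟙 _)
  have h₂ := trace_tightening (𝟙 _) (codiag V ≫ diag V) p
  rw [trace_codiag_diag] at h₂
  simp only [MonoidalCategory.whiskerLeft_id, Category.comp_id, Category.id_comp] at h₁ h₂
  rw [star, ← h₁]
  -- The bound `p` becomes a trace over `V`, because `tr (∇ ; Δ)` is the identity.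
  conv_rhs => rw [← h₂]
  refine trace_le_trace (s := p) ?_
  have h₃ : p ▷ mono T V ≫ mono T U ◁ p ≫ f ▷ mono T U ≫ codiag U ≫ diag U =
      (p ≫ f ⊗ₘ p) ≫ codiag U ≫ diag U := by
    rw [whisker_exchange_assoc]
    simp [MonoidalCategory.tensorHom_def]
  rw [h₃, Category.assoc, ← MonoidalCategory.tensorHom_def']
  exact (comp_le_comp (tensor_le_tensor h le_rfl) le_rfl).trans hp

end KCT

/-! ### Induction in extensions of the Peano theory. -/

theorem Peano.topArrow_le {T : KCTheory.{u, v}} (e : Peano.theory.Extension T) :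
    Peano.topArrow e ≤ Peano.zeroArrow e ≫
      KCT.star (U := [e.sort ()]) (Peano.succArrow e) := by
  have h := e.ax_mem (.emb (.codischarger ()), Peano.zero.seq (Peano.succ.star Peano.carrier))
    (.inr (.inr (.inr (.inr rfl))))
  have hs : Tape.HasType (.emb (.gen (e.symbol Peano.Symbol.succ))) [[e.sort ()]]
      [[e.sort ()]] := by
    have h := Circ.HasType.gen (Γ := T.sig) (e.symbol Peano.Symbol.succ)
    rw [e.ar_symbol Peano.Symbol.succ, e.coar_symbol Peano.Symbol.succ] at h
    exact .emb h
  have hz : Tape.HasType (.emb (.gen (e.symbol Peano.Symbol.zero))) [[]] [[e.sort ()]] := by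
    have h := Circ.HasType.gen (Γ := T.sig) (e.symbol Peano.Symbol.zero)
    rw [e.ar_symbol Peano.Symbol.zero, e.coar_symbol Peano.Symbol.zero] at h
    exact .emb h
  -- The axiom concerns the syntactic star of a tape, which `star_ofTape` identifies with the star
  -- of the arrow.
  refine le_trans ?_ (congrArg (Peano.zeroArrow e ≫ ·)
    (KCT.star_ofTape (U := [e.sort ()]) hs).symm).le
  exact Precong.ax (.inr h) (.emb (.codischarger _))
    (.seq hz (.tr (.seq (.seq (.plus hs (.id _)) (.codiag _)) (.diag _))))

theorem theorem7p1 (T : KCTheory.{u, v}) (e : Peano.theory.Extension T)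
    (P : Peano.one e ⟶ Peano.obj e)
    (base : Peano.zeroArrow e ≤ P)
    (step : P ≫ Peano.succArrow e ≤ P) :
    Peano.topArrow e ≤ P :=
  (Peano.topArrow_le e).trans ((KCT.comp_le_comp base le_rfl).trans
    (KCT.comp_star_le (U := [e.sort ()]) (V := []) step))
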